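/- Let $\mathbb{F}$ be a field. A $\Sigma\Pi\Sigma(k,d)$ circuit over $\mathbb{F}$ in variables $x_1,\dots,x_n$ is a formal sum $C=\sum_{i=1}^k T_i$ of $k$ multiplication terms $T_i=c_i\prod_{j=1}^d \ell_{i,j}$, where $c_i\in\mathbb{F}^*$ and each $\ell_{i,j}$ is a nonzero linear form (homogeneous of degree $1$) in $x_1,\dots,x_n$. The circuit $C$ is an identity if $\sum_{i=1}^k T_i$ is the zero polynomial; it is simple if no nonzero linear form divides all of $T_1,\dots,T_k$; it is minimal if $\sum_{i\in S}T_i\neq 0$ for every nonempty proper subset $S\subset\{1,\dots,k\}$. The rank of $C$ is the dimension of the $\mathbb{F}$-span of all the forms $\ell_{i,j}$, and the independent-fanin of $C$ is the largest size of a set $I\subseteq\{1,\dots,k\}$ such that the polynomials $T_i$, $i\in I$, are linearly independent over $\mathbb{F}$. A finite set $S\subset\mathbb{F}^N$ of nonzero vectors, no two of which are scalar multiples of each other, is called $\mathrm{SG}_r$-closed if for every set $V\subseteq S$ of $r$ linearly independent vectors the linear span of $V$ contains at least $r+1$ vectors of $S$. Let $\mathrm{SG}_r(\mathbb{F},m)$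 be the largest possible rank (dimension of the span) of an $\mathrm{SG}_r$-closed set of at most $m$ vectors in $\mathbb{F}^N$, over all $N$ (and $0$ if there is no such set, which happens only for $r=0$). Theorem. Assume $|\mathbb{F}|>d$, and let $C$ be a simple and minimal $\Sigma\Pi\Sigma(k,d)$ identity over $\mathbb{F}$ with independent-fanin $k'$. Then $$\mathrm{rank}(C)\le 2k^2+(k-k')\cdot \mathrm{SG}_{k'}(\mathbb{F},d),$$ and also $$\mathrm{rank}(C)\le 2k^2+k\cdot \mathrm{SG}_{k}(\mathbb{F},d).$$ -/

import Mathlib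

namespace DepthThree

noncomputable section

/-- The linear form `a₁x₁ + ⋯ + aₙxₙ` with coefficient vector `a`. -/
def linForm {F : Type*} [Field F] {n : ℕ} (a : Fin n → F) : MvPolynomial (Fin n) F :=
  ∑ i, MvPolynomial.C (a i) * MvPolynomial.X i

/-- A `ΣΠΣ(k,d)` circuit in `n` variables over `F`: `k` multiplication terms, each a nonzero
scalar times a list of `d` nonzero linear forms (given by their coefficient vectors). -/
structure Circuit (F : Type*) [Field F] (n k d : ℕ) where
  coeff : Fin k → F
  coeff_ne_zero : ∀ i, coeff i ≠ 0
  form : Fin k → Fin d → (Fin n → F)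
  form_ne_zero : ∀ i j, form i j ≠ 0

namespace Circuit

variable {F : Type*} [Field F] {n k d : ℕ}

/-- The polynomial computed by the `i`-th multiplication term. -/
def term (C : Circuit F n k d) (i : Fin k) : MvPolynomial (Fin n) F :=
  MvPolynomial.C (C.coeff i) * ∏ j, linForm (C.form i j)

/-- The circuit computes the zero polynomial. -/
def IsIdentity (C : Circuit F n k d) : Prop :=
  ∑ i, C.term i = 0

/-- No nonzero linear form divides all the terms. -/
def IsSimple (C : Circuit F n k d) : Prop :=
  ¬ ∃ a : Fin n → F, a ≠ 0 ∧ ∀ i, linForm a ∣ C.term i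

/-- No nonempty proper subset of the terms sums to zero. -/
def IsMinimal (C : Circuit F n k d) : Prop :=
  ∀ S : Finset (Fin k), S.Nonempty → S ≠ Finset.univ → ∑ i ∈ S, C.term i ≠ 0

/-- The rank of the set of all linear forms of the circuit. -/
def rank (C : Circuit F n k d) : ℕ :=
  Module.finrank F (Submodule.span F {a : Fin n → F | ∃ i j, C.form i j = a})

open scoped Classical in
/-- The independent-fanin: the largest size of a set `I` of indices such that the polynomials
`T i`, `i ∈ I`, are linearly independent. -/
def indFanin (C : Circuit F n k d) : ℕ :=
  (Finset.univ.filter fun I : Finset (Fin k) =>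
    LinearIndependent F (fun i : I => C.term i)).sup Finset.card

end Circuit

/-- A finite set `S` of nonzero vectors, no two of which are scalar multiples of each other, is
`SG_k`-closed if the span of any `k` linearly independent vectors of `S` contains at least
`k + 1` vectors of `S`. -/
def SGClosed {F : Type*} [Field F] {n : ℕ} (k : ℕ) (S : Finset (Fin n → F)) : Prop :=
  (∀ v ∈ S, v ≠ 0) ∧
  (∀ u ∈ S, ∀ v ∈ S, u ≠ v → ∀ c : F, u ≠ c • v) ∧
  ∀ V : Finset (Fin n → F), V ⊆ S → V.card = k →
    LinearIndependent F (fun v : V => (v : Fin n → F)) →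
    k + 1 ≤ {v : Fin n → F | v ∈ S ∧ v ∈ Submodule.span F (V : Set (Fin n → F))}.ncard

/-- `SG_k(F, m)`: the largest rank of an `SG_k`-closed set of at most `m` vectors in `F^n`, over
all `n`. Such a rank is at most `m`, so for `1 ≤ k` (where `∅` is `SG_k`-closed) this supremum is
attained. -/
def SG (F : Type*) [Field F] (k m : ℕ) : ℕ :=
  sSup {r : ℕ | ∃ (n : ℕ) (S : Finset (Fin n → F)), S.card ≤ m ∧ SGClosed k S ∧
    Module.finrank F (Submodule.span F (S : Set (Fin n → F))) = r}

end

end DepthThree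

/-! The forms are compared modulo a subspace `K` of dimension at most `2 * k ^ 2`, and what varies
between terms outside `K` is a union of `k - k'` Sylvester-Gallai configurations.

The tool is an ideal generated by products of forms of `K`: forms outside `K` are nonzerodivisors
modulo it. Chinese remaindering then shows that a nonzero partial sum stays nonzero modulo such an
ideal while becoming a multiple of a single term (`Based.exists_certificate`). By minimality this
applies to a proper set of terms and then to its complement. It yields a term inside and a term
outside that agree up to a scalar, hence have the same forms modulo `K` up to order and scalars
(`Based.matched`). Repeating this matches all terms at a cost of at most `k ^ 2` dimensions
(`Circuit.exists_matched`). At most `k ^ 2` further dimensions make the parts inside `K` of a basis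
of terms independent (`exists_linearIndependent_innerPart`).

Each of the `k - k'` terms outside the basis gives a relation with at most `k' + 1` terms, which is
minimal on the parts inside `K`. Group the forms outside `K` into classes modulo `K` and scalars.
The classes whose product differs between terms of the relation form a closed set
(`sgClosed_varyingClasses`). Otherwise some independent classes span no further varying class, and a
dimension count (`exists_subset_sum_eq_zero_of_orthogonal`) produces a vanishing proper subsum.

A class varying in none of these relations has the same product in all terms, since minimality
connects the relations (`eq_of_constant_on_relations`). Its forms would divide every term, against
simplicity. So `K` and the `k - k'` closed sets span all forms. -/

namespace DepthThree

noncomputable section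

open MvPolynomial

/-! ### Linear forms and the substitutions that deform them -/

section LinearForms

variable {F : Type*} [Field F] {n : ℕ}

/-- `linForm` as a linear map. -/
def linFormL : (Fin n → F) →ₗ[F] MvPolynomial (Fin n) F where
  toFun := linForm
  map_add' a b := by simp [linForm, add_mul, Finset.sum_add_distrib]
  map_smul' c a := by
    simp [linForm, MvPolynomial.smul_eq_C_mul, Finset.mul_sum, mul_assoc]

@[simp] lemma linFormL_apply (a : Fin n → F) : linFormL a = linForm a := rfl

lemma coeff_linForm (a : Fin n → F) (i : Fin n) :
    (linForm a).coeff (Finsupp.single i 1) = a i := by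
  classical
  simp [linForm, MvPolynomial.coeff_sum, MvPolynomial.coeff_C_mul, MvPolynomial.coeff_X,
    Finsupp.single_left_inj]

lemma linForm_injective : Function.Injective (linForm : (Fin n → F) → _) := fun a b h => by
  funext i
  rw [← coeff_linForm a i, h, coeff_linForm]

lemma linForm_zero : linForm (0 : Fin n → F) = 0 := linFormL.map_zero

lemma linForm_eq_zero {a : Fin n → F} : linForm a = 0 ↔ a = 0 := by
  rw [← linForm_zero]; exact linForm_injective.eq_iff

lemma linForm_smul (c : F) (a : Fin n → F) : linForm (c • a) = C c * linForm a := by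
  rw [← linFormL_apply, map_smul, smul_eq_C_mul]; rfl

/-- The algebra homomorphism out of the polynomial ring given by a linear map on forms. -/
def liftForms {B : Type*} [CommRing B] [Algebra F B] (φ : (Fin n → F) →ₗ[F] B) :
    MvPolynomial (Fin n) F →ₐ[F] B :=
  aeval fun i => φ (Pi.single i 1)

lemma liftForms_linForm {B : Type*} [CommRing B] [Algebra F B] (φ : (Fin n → F) →ₗ[F] B)
    (a : Fin n → F) : liftForms φ (linForm a) = φ a := by
  conv_rhs => rw [← LinearMap.sum_single_apply (φ := fun _ => F) a]
  simp only [liftForms, linForm, map_sum, map_mul, aeval_C, aeval_X]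
  refine Finset.sum_congr rfl fun i _ => ?_
  rw [← Algebra.smul_def, ← map_smul]
  congr 1
  ext j
  simp [Pi.single_apply]

/-- The homomorphism `R → R[t]` with `a ↦ u a + w a * t` on linear forms `a`. -/
def pencil (u w : (Fin n → F) →ₗ[F] MvPolynomial (Fin n) F) :
    MvPolynomial (Fin n) F →ₐ[F] Polynomial (MvPolynomial (Fin n) F) :=
  liftForms
    { toFun := fun a => Polynomial.C (u a) + Polynomial.C (w a) * Polynomial.X
      map_add' := fun a b => by simp only [map_add]; ring
      map_smul' := fun c a => by
        simp only [map_smul, RingHom.id_apply, smul_add, ← Polynomial.smul_C, smul_mul_assoc] }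

lemma pencil_linForm (u w : (Fin n → F) →ₗ[F] MvPolynomial (Fin n) F) (a : Fin n → F) :
    pencil u w (linForm a) = Polynomial.C (u a) + Polynomial.C (w a) * Polynomial.X :=
  liftForms_linForm _ a

lemma pencil_C (u w : (Fin n → F) →ₗ[F] MvPolynomial (Fin n) F) (c : F) :
    pencil u w (C c) = Polynomial.C (C c) :=
  (pencil u w).commutes c

/-- The translation `a ↦ a + λ(a) t`. -/
def translate (l : (Fin n → F) →ₗ[F] F) :
    MvPolynomial (Fin n) F →ₐ[F] Polynomial (MvPolynomial (Fin n) F) :=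
  pencil linFormL (Algebra.linearMap F _ ∘ₗ l)

lemma translate_linForm (l : (Fin n → F) →ₗ[F] F) (a : Fin n → F) :
    translate l (linForm a) =
      Polynomial.C (linForm a) + Polynomial.C (C (l a)) * Polynomial.X :=
  pencil_linForm _ _ a

/-- The homomorphism `a ↦ (a - q a) + q a * t`. -/
def spread (q : (Fin n → F) →ₗ[F] (Fin n → F)) :
    MvPolynomial (Fin n) F →ₐ[F] Polynomial (MvPolynomial (Fin n) F) :=
  pencil (linFormL ∘ₗ (LinearMap.id - q)) (linFormL ∘ₗ q)

lemma spread_linForm (q : (Fin n → F) →ₗ[F] (Fin n → F)) (a : Fin n → F) :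
    spread q (linForm a) =
      Polynomial.C (linForm (a - q a)) + Polynomial.C (linForm (q a)) * Polynomial.X :=
  pencil_linForm _ _ a

/-- Factors over `s` are constant and the others have degree at most one, so this is the top
possible coefficient. It isolates the part of a product over `s`. -/
lemma coeff_prod_pencil {ι R : Type*} [CommRing R] [DecidableEq ι] (s t : Finset ι)
    (hst : s ⊆ t) (x y : ι → R) (h : ∀ j ∈ s, y j = 0) :
    (∏ j ∈ t, (Polynomial.C (x j) + Polynomial.C (y j) * Polynomial.X)).coeff (t \ s).card =
      (∏ j ∈ s, x j) * ∏ j ∈ t \ s, y j := by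
  rw [← Finset.prod_sdiff hst, mul_comm]
  have h1 : ∏ j ∈ s, (Polynomial.C (x j) + Polynomial.C (y j) * Polynomial.X) =
      Polynomial.C (∏ j ∈ s, x j) := by
    rw [map_prod]
    exact Finset.prod_congr rfl fun j hj => by simp [h j hj]
  rw [h1, Polynomial.coeff_C_mul]
  congr 1
  have := Polynomial.coeff_prod_of_natDegree_le (s := t \ s)
    (fun j => Polynomial.C (x j) + Polynomial.C (y j) * Polynomial.X) 1 (fun j _ => by
      refine (Polynomial.natDegree_add_le _ _).trans ?_
      simpa using Polynomial.natDegree_C_mul_X_pow_le (y j) 1)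
  rw [mul_one] at this
  rw [this]
  exact Finset.prod_congr rfl fun j _ => by simp

/-- Every subspace is the kernel of an idempotent endomorphism. -/
lemma exists_projection (K : Submodule F (Fin n → F)) :
    ∃ q : (Fin n → F) →ₗ[F] (Fin n → F), (∀ a, q a = 0 ↔ a ∈ K) ∧ ∀ a, q (q a) = q a := by
  obtain ⟨Z, hZ⟩ := K.exists_isCompl
  exact ⟨Z.projection K hZ.symm, fun a => Submodule.projection_apply_eq_zero_iff _, fun a =>
    Submodule.projection_apply_of_mem_left _ (Submodule.projection_apply_mem _ a)⟩

lemma exists_functional {K : Submodule F (Fin n → F)} {a : Fin n → F} (ha : a ∉ K) :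
    ∃ l : (Fin n → F) →ₗ[F] F, (∀ b ∈ K, l b = 0) ∧ l a = 1 := by
  obtain ⟨f, hf, hK⟩ := Submodule.exists_dual_map_eq_bot_of_notMem ha inferInstance
  refine ⟨(f a)⁻¹ • f, fun b hb => ?_, by simp [hf]⟩
  have : f b ∈ K.map f := ⟨b, hb, rfl⟩
  rw [hK, Submodule.mem_bot] at this
  simp [this]

end LinearForms

/-! ### Ideals generated by products of forms of a subspace, and certificates -/

section Based

variable {F : Type*} [Field F] {n : ℕ}

/-- The product of a multiset of linear forms. -/
def formProd (s : Multiset (Fin n → F)) : MvPolynomial (Fin n) F := (s.map linForm).prod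

lemma formProd_add (s t : Multiset (Fin n → F)) : formProd (s + t) = formProd s * formProd t := by
  simp [formProd]

lemma formProd_map {ι : Type*} (s : Finset ι) (a : ι → Fin n → F) :
    formProd (s.val.map a) = ∏ j ∈ s, linForm (a j) := by
  rw [formProd, Multiset.map_map]; rfl

/-- The ideal `I` is generated by products of linear forms of `K`. -/
def Based (K : Submodule F (Fin n → F)) (I : Ideal (MvPolynomial (Fin n) F)) : Prop :=
  ∃ G : Set (Multiset (Fin n → F)), (∀ s ∈ G, ∀ a ∈ s, a ∈ K) ∧ I = Ideal.span (formProd '' G)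

lemma based_bot (K : Submodule F (Fin n → F)) : Based K ⊥ := ⟨∅, by simp, by simp⟩

lemma Based.sup_span {K K' : Submodule F (Fin n → F)} {I : Ideal (MvPolynomial (Fin n) F)}
    (h : Based K I) (hK : K ≤ K') {s : Multiset (Fin n → F)} (hs : ∀ a ∈ s, a ∈ K') :
    Based K' (I ⊔ Ideal.span {formProd s}) := by
  obtain ⟨G, hG, rfl⟩ := h
  refine ⟨G ∪ {s}, ?_, ?_⟩
  · rintro t (ht | rfl) a ha
    · exact hK (hG t ht a ha)
    · exact hs a ha
  · rw [Set.image_union, Set.image_singleton, Ideal.span_union]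

lemma Based.mono {K K' : Submodule F (Fin n → F)} {I : Ideal (MvPolynomial (Fin n) F)}
    (h : Based K I) (hK : K ≤ K') : Based K' I := by
  obtain ⟨G, hG, hI⟩ := h
  exact ⟨G, fun s hs a ha => hK (hG s hs a ha), hI⟩

/-- Each generator is multiplied by a power of `y`, so the ideal is carried into its extension.
Translations and spreads use `y = 1`, scaling uses `y = X`. -/
lemma Based.map_mem {K : Submodule F (Fin n → F)} {I : Ideal (MvPolynomial (Fin n) F)}
    (h : Based K I) (φ : MvPolynomial (Fin n) F →ₐ[F] Polynomial (MvPolynomial (Fin n) F))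
    (y : Polynomial (MvPolynomial (Fin n) F))
    (hφ : ∀ a ∈ K, φ (linForm a) = Polynomial.C (linForm a) * y)
    {x : MvPolynomial (Fin n) F} (hx : x ∈ I) : φ x ∈ I.map Polynomial.C := by
  obtain ⟨G, hG, rfl⟩ := h
  have : Ideal.span (formProd '' G) ≤
      ((Ideal.span (formProd '' G)).map Polynomial.C).comap φ.toRingHom := by
    rw [Ideal.span_le]
    rintro _ ⟨s, hs, rfl⟩
    have h1 : φ (formProd s) = Polynomial.C (formProd s) * y ^ s.card := by
      have : ∀ t : Multiset (Fin n → F), (∀ a ∈ t, a ∈ K) →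
          φ (formProd t) = Polynomial.C (formProd t) * y ^ t.card := by
        intro t
        induction t using Multiset.induction_on with
        | empty => intro _; simp [formProd]
        | cons a t ih =>
          intro ht
          have e : ∀ t : Multiset (Fin n → F), formProd (a ::ₘ t) = linForm a * formProd t := by
            simp [formProd]
          rw [e, map_mul, ih fun b hb => ht b (Multiset.mem_cons_of_mem hb),
            hφ a (ht a (Multiset.mem_cons_self a t)), map_mul, Multiset.card_cons, pow_succ]
          ring
      exact this s (hG s hs)
    rw [SetLike.mem_coe, Ideal.mem_comap]
    change φ (formProd s) ∈ Ideal.map Polynomial.C (Ideal.span (formProd '' G))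
    rw [h1]
    exact Ideal.mul_mem_right _ _
      (Ideal.mem_map_of_mem _ (Ideal.subset_span (Set.mem_image_of_mem _ hs)))
  exact this hx

lemma Based.translate_mem {K : Submodule F (Fin n → F)} {I : Ideal (MvPolynomial (Fin n) F)}
    (h : Based K I) {l : (Fin n → F) →ₗ[F] F} (hl : ∀ a ∈ K, l a = 0)
    {x : MvPolynomial (Fin n) F} (hx : x ∈ I) : translate l x ∈ I.map Polynomial.C :=
  h.map_mem (translate l) 1 (fun a ha => by simp [translate_linForm, hl a ha]) hx

lemma Based.coeff_spread_mem {K : Submodule F (Fin n → F)} {I : Ideal (MvPolynomial (Fin n) F)}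
    (h : Based K I) {q : (Fin n → F) →ₗ[F] (Fin n → F)} (hq : ∀ a ∈ K, q a = 0)
    {x : MvPolynomial (Fin n) F} (hx : x ∈ I) (m : ℕ) : (spread q x).coeff m ∈ I := by
  have h1 : spread q x ∈ I.map Polynomial.C :=
    h.map_mem (spread q) 1 (fun a ha => by simp [spread_linForm, hq a ha, linForm_zero]) hx
  exact Ideal.mem_map_C_iff.1 h1 m

lemma X_eq_linForm (i : Fin n) : (X i : MvPolynomial (Fin n) F) = linForm (Pi.single i 1) := by
  simp [linForm, Pi.single_apply, apply_ite C]

lemma coeff_zero_translate (l : (Fin n → F) →ₗ[F] F) (x : MvPolynomial (Fin n) F) :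
    (translate l x).coeff 0 = x := by
  have : ((Polynomial.aeval (R := MvPolynomial (Fin n) F)
      (0 : MvPolynomial (Fin n) F)).restrictScalars F).comp (translate l) = AlgHom.id F _ := by
    refine MvPolynomial.algHom_ext fun i => ?_
    rw [X_eq_linForm, AlgHom.comp_apply, translate_linForm]
    simp
  have h2 := congrArg (fun f => f x) this
  simpa [Polynomial.coeff_zero_eq_aeval_zero] using h2

/-- The homomorphism `a ↦ a * t`. -/
def scaling : MvPolynomial (Fin n) F →ₐ[F] Polynomial (MvPolynomial (Fin n) F) :=
  pencil 0 linFormL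

lemma scaling_linForm (a : Fin n → F) :
    scaling (linForm a) = Polynomial.C (linForm a) * Polynomial.X := by
  simp [scaling, pencil_linForm]

lemma coeff_zero_scaling (x : MvPolynomial (Fin n) F) :
    (scaling x).coeff 0 = C (constantCoeff x) := by
  have : ((Polynomial.aeval (R := MvPolynomial (Fin n) F)
      (0 : MvPolynomial (Fin n) F)).restrictScalars F).comp scaling =
      (Algebra.ofId F (MvPolynomial (Fin n) F)).comp (aeval fun _ => (0 : F)) := by
    refine MvPolynomial.algHom_ext fun i => ?_
    rw [AlgHom.comp_apply, AlgHom.comp_apply, aeval_X, map_zero, X_eq_linForm, scaling_linForm]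
    simp
  have h2 := congrArg (fun f => f x) this
  simpa [Polynomial.coeff_zero_eq_aeval_zero, Algebra.ofId_apply] using h2

lemma scaling_prod {d : ℕ} (a : Fin d → Fin n → F) :
    scaling (∏ j, linForm (a j)) = Polynomial.C (∏ j, linForm (a j)) * Polynomial.X ^ d := by
  simp [map_prod, scaling_linForm, Finset.prod_mul_distrib]

lemma mem_map_C_iff_map_mk {R : Type*} [CommRing R] {I : Ideal R} {p : Polynomial R} :
    p ∈ I.map Polynomial.C ↔ p.map (Ideal.Quotient.mk I) = 0 := by
  rw [Ideal.mem_map_C_iff, Polynomial.ext_iff]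
  simp [Ideal.Quotient.eq_zero_iff_mem]

/-- A linear form outside `K` is a nonzerodivisor modulo an ideal based on `K`. -/
lemma Based.mem_of_linForm_mul_mem {K : Submodule F (Fin n → F)}
    {I : Ideal (MvPolynomial (Fin n) F)} (h : Based K I) {a : Fin n → F} (ha : a ∉ K)
    {x : MvPolynomial (Fin n) F} (hx : linForm a * x ∈ I) : x ∈ I := by
  -- Translation along `l` respects `I` and makes the form monic in the new variable; a monic
  -- polynomial is a nonzerodivisor over any quotient.
  obtain ⟨l, hl, hla⟩ := exists_functional ha
  have h1 := h.translate_mem hl hx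
  rw [map_mul, translate_linForm, hla, mem_map_C_iff_map_mk, Polynomial.map_mul] at h1
  have h2 : (Polynomial.map (Ideal.Quotient.mk I)
      (Polynomial.C (linForm a) + Polynomial.C (C 1) * Polynomial.X)).Monic := by
    simpa [add_comm] using Polynomial.monic_X_add_C (Ideal.Quotient.mk I (linForm a))
  rw [h2.mul_right_eq_zero_iff, ← mem_map_C_iff_map_mk, Ideal.mem_map_C_iff] at h1
  simpa [coeff_zero_translate] using h1 0

lemma Based.mem_of_formProd_mul_mem {K : Submodule F (Fin n → F)}
    {I : Ideal (MvPolynomial (Fin n) F)} (h : Based K I) {s : Multiset (Fin n → F)}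
    (hs : ∀ a ∈ s, a ∉ K) {x : MvPolynomial (Fin n) F} (hx : formProd s * x ∈ I) : x ∈ I := by
  induction s using Multiset.induction_on generalizing x with
  | empty => simpa [formProd] using hx
  | cons a s ih =>
    refine ih (fun b hb => hs b (Multiset.mem_cons_of_mem hb))
      (h.mem_of_linForm_mul_mem (hs a (Multiset.mem_cons_self a s)) ?_)
    simpa [formProd, mul_assoc] using hx

lemma formProd_dvd_of_le {s t : Multiset (Fin n → F)} (h : s ≤ t) : formProd s ∣ formProd t :=
  Multiset.prod_dvd_prod_of_le (Multiset.map_le_map h)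

open scoped Classical in
/-- Chinese remaindering for products of linear forms, modulo an ideal based on `K`. -/
lemma Based.exists_notMem_sup_node {K : Submodule F (Fin n → F)}
    {I : Ideal (MvPolynomial (Fin n) F)} (h : Based K I) (s : Multiset (Fin n → F))
    {x : MvPolynomial (Fin n) F} (hx : x ∉ I ⊔ Ideal.span {formProd s}) :
    ∃ a ∈ s, x ∉ I ⊔ Ideal.span {formProd (s.filter (· ∈ K ⊔ Submodule.span F {a}))} := by
  induction hm : s.card using Nat.strong_induction_on generalizing s with
  | _ m ih =>
  rcases s.empty_or_exists_mem with rfl | ⟨a, ha⟩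
  · exact absurd (by simp [formProd]) hx
  by_contra! hall
  set K' := K ⊔ Submodule.span F {a}
  set s₁ := s.filter (· ∈ K')
  set s₂ := s.filter (· ∉ K')
  have hs : s₁ + s₂ = s := Multiset.filter_add_not _ s
  have ha₁ : a ∈ s₁ := Multiset.mem_filter.2
    ⟨ha, Submodule.mem_sup_right (Submodule.mem_span_singleton_self a)⟩
  have hcard : s₂.card < m := by
    have h1 := congrArg Multiset.card hs
    have h2 := Multiset.card_pos_iff_exists_mem.2 ⟨a, ha₁⟩
    rw [Multiset.card_add] at h1
    omega
  have hle : s₂ ≤ s := Multiset.filter_le _ s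
  have hx₂ : x ∈ I ⊔ Ideal.span {formProd s₂} := by
    by_contra hx₂
    obtain ⟨b, hb, hxb⟩ := ih _ hcard s₂ hx₂ rfl
    refine hxb (sup_le_sup_left (Ideal.span_singleton_le_span_singleton.2 ?_) I
      (hall b (Multiset.mem_of_le hle hb)))
    exact formProd_dvd_of_le (Multiset.filter_le_filter _ hle)
  have hx₁ := hall a ha
  have hB : Based K' (I ⊔ Ideal.span {formProd s₁}) :=
    h.sup_span le_sup_left fun b hb => (Multiset.mem_filter.1 hb).2
  obtain ⟨y, hy, z, hz, rfl⟩ := Submodule.mem_sup.1 hx₂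
  obtain ⟨w, rfl⟩ := Ideal.mem_span_singleton'.1 hz
  -- Here `x = y + w * formProd s₂`. The forms of `s₂` lie outside `K'`, so they cancel modulo `I ⊔
  -- (formProd s₁)`; then `x` lies in `I ⊔ (formProd s)`.
  have hw : w ∈ I ⊔ Ideal.span {formProd s₁} := by
    refine hB.mem_of_formProd_mul_mem (s := s₂) (fun b hb => (Multiset.mem_filter.1 hb).2) ?_
    rw [mul_comm]
    exact (Submodule.add_mem_iff_right _ (Ideal.mem_sup_left hy)).1 hx₁
  obtain ⟨y', hy', z', hz', rfl⟩ := Submodule.mem_sup.1 hw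
  obtain ⟨w', rfl⟩ := Ideal.mem_span_singleton'.1 hz'
  refine hx (Ideal.add_mem _ (Ideal.mem_sup_left hy) ?_)
  rw [add_mul]
  refine Ideal.add_mem _ (Ideal.mem_sup_left (Ideal.mul_mem_right _ _ hy'))
    (Ideal.mem_sup_right (Ideal.mem_span_singleton'.2 ⟨w', ?_⟩))
  rw [← hs, formProd_add, mul_assoc]

/-- A combination of products of `d` linear forms that does not vanish modulo `I` becomes a nonzero
multiple of a single one of them modulo a based ideal of slightly larger rank. -/
lemma Based.exists_certificate {ι : Type*} [DecidableEq ι] {d : ℕ} (a : ι → Fin d → Fin n → F)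
    (b : ι → F) (A : Finset ι) {K : Submodule F (Fin n → F)}
    {I : Ideal (MvPolynomial (Fin n) F)} (h : Based K I)
    (hA : ∑ i ∈ A, C (b i) * ∏ j, linForm (a i j) ∉ I) :
    ∃ (K' : Submodule F (Fin n → F)) (I' : Ideal (MvPolynomial (Fin n) F)), Based K' I' ∧
      K ≤ K' ∧ I ≤ I' ∧ Module.finrank F K' + 1 ≤ Module.finrank F K + A.card ∧
      ∑ i ∈ A, C (b i) * ∏ j, linForm (a i j) ∉ I' ∧
      ∃ i₀ ∈ A, ∃ c : F, ∑ i ∈ A, C (b i) * ∏ j, linForm (a i j) -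
        C c * ∏ j, linForm (a i₀ j) ∈ I' := by
  classical
  induction A using Finset.induction_on generalizing K I with
  | empty => simp at hA
  | insert i₀ A hi ih =>
    by_cases hmem : ∑ i ∈ insert i₀ A, C (b i) * ∏ j, linForm (a i j) ∈
        I ⊔ Ideal.span {formProd (Finset.univ.val.map (a i₀))}
    · refine ⟨K, I, h, le_rfl, le_rfl, ?_, hA, i₀, Finset.mem_insert_self _ _, ?_⟩
      · rw [Finset.card_insert_of_notMem hi]; omega
      obtain ⟨y, hy, z, hz, hyz⟩ := Submodule.mem_sup.1 hmem
      obtain ⟨w, rfl⟩ := Ideal.mem_span_singleton'.1 hz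
      -- All products are homogeneous of degree `d`, so in degree `d` only the constant term of the
      -- multiplier survives.
      refine ⟨constantCoeff w, ?_⟩
      have h1 := congrArg (fun p => (scaling p).coeff d) hyz
      simp only [map_add, map_mul, map_sum, formProd_map, scaling_prod,
        Polynomial.coeff_add, Polynomial.finsetSum_coeff] at h1
      have h2 : ∀ i, (scaling (C (b i)) * (Polynomial.C (∏ j, linForm (a i j)) *
          Polynomial.X ^ d)).coeff d = C (b i) * ∏ j, linForm (a i j) := fun i => by
        rw [scaling, pencil_C, ← mul_assoc, ← map_mul]
        rw [Polynomial.coeff_C_mul, Polynomial.coeff_X_pow_self, mul_one]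
      simp only [h2] at h1
      rw [← mul_assoc, Polynomial.coeff_mul_X_pow', if_pos le_rfl, Nat.sub_self,
        Polynomial.coeff_mul_C, coeff_zero_scaling] at h1
      rw [← h1, add_sub_cancel_right]
      exact Ideal.mem_map_C_iff.1 (h.map_mem scaling _ (fun a _ => scaling_linForm a) hy) d
    -- Adjoining one node of the term `i₀` kills that term, keeps the sum nonzero, and costs one
    -- dimension.
    · obtain ⟨x, hx, hnot⟩ := h.exists_notMem_sup_node _ hmem
      set s := (Finset.univ.val.map (a i₀)).filter (· ∈ K ⊔ Submodule.span F {x})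
      have hB : Based (K ⊔ Submodule.span F {x}) (I ⊔ Ideal.span {formProd s}) :=
        h.sup_span le_sup_left fun b hb => (Multiset.mem_filter.1 hb).2
      have hi₀ : C (b i₀) * ∏ j, linForm (a i₀ j) ∈ I ⊔ Ideal.span {formProd s} := by
        refine Ideal.mem_sup_right (Ideal.mul_mem_left _ _ (Ideal.mem_span_singleton.2 ?_))
        rw [← formProd_map]
        exact formProd_dvd_of_le (Multiset.filter_le _ _)
      rw [Finset.sum_insert hi] at hnot ⊢
      rw [Submodule.add_mem_iff_right _ hi₀] at hnot
      obtain ⟨K', I', hB', hK', hI', hr, hne, i₁, hi₁, c, hc⟩ := ih hB hnot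
      refine ⟨K', I', hB', le_sup_left.trans hK', le_sup_left.trans hI', ?_, ?_, i₁,
        Finset.mem_insert_of_mem hi₁, c, ?_⟩
      · have h1 := Submodule.finrank_add_le_finrank_add_finrank K (Submodule.span F {x})
        have h2 : Module.finrank F (Submodule.span F {x}) ≤ 1 := by
          simpa using finrank_span_le_card (R := F) ({x} : Set (Fin n → F))
        rw [Finset.card_insert_of_notMem hi]
        omega
      · rwa [Submodule.add_mem_iff_right _ (hI' hi₀)]
      · rw [add_sub_assoc]
        exact Ideal.add_mem _ (hI' hi₀) hc

end Based

/-! ### Matching the forms of all terms modulo a small subspace -/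

section Matching

variable {F : Type*} [Field F] {n : ℕ}

open scoped Classical in
/-- A canonical representative of the class of `v` up to nonzero scalars. -/
def normalize (v : Fin n → F) : Fin n → F :=
  if h : v = 0 then 0 else (Projectivization.mk F v h).rep

lemma exists_eq_smul_normalize (v : Fin n → F) : ∃ c : F, c ≠ 0 ∧ v = c • normalize v := by
  by_cases h : v = 0
  · exact ⟨1, one_ne_zero, by simp [normalize, h]⟩
  · obtain ⟨u, hu⟩ := Projectivization.exists_smul_eq_mk_rep F v h
    refine ⟨(u⁻¹ : Fˣ), Units.ne_zero _, ?_⟩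
    rw [normalize, dif_neg h, ← hu, ← Units.smul_def, inv_smul_smul]

lemma normalize_eq_zero {v : Fin n → F} : normalize v = 0 ↔ v = 0 := by
  obtain ⟨c, hc, hv⟩ := exists_eq_smul_normalize v
  constructor
  · intro h; rw [hv, h, smul_zero]
  · intro h; rw [h] at hv ⊢; exact (smul_eq_zero.1 hv.symm).resolve_left hc

lemma normalize_smul {c : F} (hc : c ≠ 0) (v : Fin n → F) : normalize (c • v) = normalize v := by
  by_cases h : v = 0
  · simp [h]
  · rw [normalize, normalize, dif_neg h, dif_neg (smul_ne_zero hc h)]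
    congr 1
    rw [Projectivization.mk_eq_mk_iff']
    exact ⟨c, rfl⟩

lemma exists_eq_smul_of_normalize_eq {v w : Fin n → F} (h : normalize v = normalize w) :
    ∃ c : F, c ≠ 0 ∧ w = c • v := by
  obtain ⟨c, hc, hv⟩ := exists_eq_smul_normalize v
  obtain ⟨c', hc', hw⟩ := exists_eq_smul_normalize w
  refine ⟨c' * c⁻¹, mul_ne_zero hc' (inv_ne_zero hc), ?_⟩
  rw [hw, ← h, mul_smul]
  congr 1
  rw [eq_inv_smul_iff₀ hc, ← hv]

/-- The count over `x₀` is forced by the total. The exceptional value serves the class `0` of forms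
lying in `K`. -/
lemma exists_perm_of_card_fiber_eq {α β : Type*} [Fintype α] [DecidableEq β] (f g : α → β) (x₀ : β)
    (h : ∀ x ≠ x₀, (Finset.univ.filter (f · = x)).card = (Finset.univ.filter (g · = x)).card) :
    ∃ σ : Equiv.Perm α, ∀ j, g (σ j) = f j := by
  have h₀ : (Finset.univ.filter (f · = x₀)).card = (Finset.univ.filter (g · = x₀)).card := by
    have key : ∀ u : α → β, Finset.univ.image u ⊆ Finset.univ.image f ∪ Finset.univ.image g →
        Fintype.card α = (Finset.univ.filter (u · = x₀)).card +
          ∑ x ∈ (Finset.univ.image f ∪ Finset.univ.image g).erase x₀,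
            (Finset.univ.filter (u · = x)).card := by
      intro u hu
      rw [← Finset.card_univ, ← Finset.card_filter_add_card_filter_not (s := Finset.univ)
        (fun j => u j = x₀)]
      congr 1
      rw [Finset.card_eq_sum_card_fiberwise (f := u)
        (t := (Finset.univ.image f ∪ Finset.univ.image g).erase x₀)]
      · refine Finset.sum_congr rfl fun x hx => ?_
        rw [Finset.filter_filter]
        congr 1
        ext j
        have := (Finset.mem_erase.1 hx).1
        simp only [Finset.mem_filter, Finset.mem_univ, true_and]
        exact ⟨fun h => h.2, fun h => ⟨h ▸ this, h⟩⟩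
      · intro j hj
        simp only [Finset.coe_filter, Finset.mem_univ, true_and, Set.mem_ofPred_eq] at hj
        exact Finset.mem_erase.2 ⟨hj, hu (Finset.mem_image_of_mem _ (Finset.mem_univ _))⟩
    have h1 := key f Finset.subset_union_left
    have h2 := key g Finset.subset_union_right
    rw [Finset.sum_congr rfl fun x hx => h x (Finset.mem_erase.1 hx).1] at h1
    omega
  have e : ∀ x, Nonempty ({j // f j = x} ≃ {j // g j = x}) := fun x => by
    refine ⟨Fintype.equivOfCardEq ?_⟩
    rw [Fintype.card_subtype, Fintype.card_subtype]
    by_cases hx : x = x₀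
    · rw [hx, h₀]
    · exact h x hx
  exact ⟨Equiv.ofFiberEquiv fun x => (e x).some, fun j => Equiv.ofFiberEquiv_map _ j⟩

lemma Based.mem_of_prod_mul_mem {K : Submodule F (Fin n → F)}
    {I : Ideal (MvPolynomial (Fin n) F)} (h : Based K I) {ι : Type*} {s : Finset ι}
    {a : ι → Fin n → F} (hs : ∀ j ∈ s, a j ∉ K) {x : MvPolynomial (Fin n) F}
    (hx : (∏ j ∈ s, linForm (a j)) * x ∈ I) : x ∈ I := by
  rw [← formProd_map] at hx
  refine h.mem_of_formProd_mul_mem (fun b hb => ?_) hx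
  obtain ⟨j, hj, rfl⟩ := Multiset.mem_map.1 hb
  exact hs j hj

lemma Based.sup_span_prod {K K' : Submodule F (Fin n → F)} {I : Ideal (MvPolynomial (Fin n) F)}
    (h : Based K I) (hK : K ≤ K') {ι : Type*} {s : Finset ι} {a : ι → Fin n → F}
    (hs : ∀ j ∈ s, a j ∈ K') : Based K' (I ⊔ Ideal.span {∏ j ∈ s, linForm (a j)}) := by
  rw [← formProd_map]
  refine h.sup_span hK fun b hb => ?_
  obtain ⟨j, hj, rfl⟩ := Multiset.mem_map.1 hb
  exact hs j hj

lemma coeff_card_translate_prod {ι : Type*} (l : (Fin n → F) →ₗ[F] F) (s : Finset ι)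
    (a : ι → Fin n → F) :
    (translate l (∏ j ∈ s, linForm (a j))).coeff s.card = C (∏ j ∈ s, l (a j)) := by
  classical
  have := coeff_prod_pencil ∅ s (Finset.empty_subset _) (fun j => linForm (a j))
    (fun j => (C (l (a j)) : MvPolynomial (Fin n) F)) (by simp)
  simpa [map_prod, translate_linForm] using this

lemma natDegree_translate_prod_le {ι : Type*} (l : (Fin n → F) →ₗ[F] F) (s : Finset ι)
    (a : ι → Fin n → F) : (translate l (∏ j ∈ s, linForm (a j))).natDegree ≤ s.card := by
  rw [map_prod]
  refine (Polynomial.natDegree_prod_le _ _).trans ?_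
  refine (Finset.sum_le_card_nsmul _ _ 1 fun j _ => ?_).trans (by simp)
  rw [translate_linForm]
  refine (Polynomial.natDegree_add_le _ _).trans ?_
  simpa using Polynomial.natDegree_C_mul_X_pow_le (C (l (a j)) : MvPolynomial (Fin n) F) 1

lemma translate_prod_eq {ι : Type*} {l : (Fin n → F) →ₗ[F] F} {s : Finset ι}
    {a : ι → Fin n → F} (h : ∀ j ∈ s, l (a j) = 0) :
    translate l (∏ j ∈ s, linForm (a j)) = Polynomial.C (∏ j ∈ s, linForm (a j)) := by
  rw [map_prod, map_prod]
  exact Finset.prod_congr rfl fun j hj => by simp [translate_linForm, h j hj]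

open scoped Classical in
-- Forms outside `K ⊔ span {x}` cancel, leaving `N * B' ≡ w * B` modulo `I`, with `N` the forms in
-- `K`. Translate along a functional that kills `K` and not `x`: `N` stays constant, while `B` and
-- `B'` get degrees equal to their cardinalities and unit leading coefficients. As `N ∉ I`, the
-- image of `w` is nonzero, and comparing degrees gives the bound.
lemma Based.card_class_le {K : Submodule F (Fin n → F)} {I : Ideal (MvPolynomial (Fin n) F)}
    (h : Based K I) {q : (Fin n → F) →ₗ[F] (Fin n → F)} (hq : ∀ a, q a = 0 ↔ a ∈ K)
    (hqq : ∀ a, q (q a) = q a) {d : ℕ} (a a' : Fin d → Fin n → F) {x : Fin n → F} (hx : x ≠ 0)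
    (ha' : ∏ j, linForm (a' j) ∉ I)
    (hmem : ∏ j, linForm (a' j) ∈ I ⊔
      Ideal.span {∏ j with normalize (q (a j)) = x, linForm (a j)}) :
    (Finset.univ.filter fun j => normalize (q (a j)) = x).card ≤
      (Finset.univ.filter fun j => normalize (q (a' j)) = x).card := by
  set B := Finset.univ.filter fun j => normalize (q (a j)) = x with hB
  set B' := Finset.univ.filter fun j => normalize (q (a' j)) = x with hB'
  rcases B.eq_empty_or_nonempty with hBe | ⟨j₀, hj₀⟩
  · simp [hBe]
  have hqx : q x = x := by
    have h1 : normalize (q (a j₀)) = x := (Finset.mem_filter.1 hj₀).2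
    obtain ⟨c, hc, hv⟩ := exists_eq_smul_normalize (q (a j₀))
    rw [h1] at hv
    have h2 : x = c⁻¹ • q (a j₀) := by rw [eq_inv_smul_iff₀ hc, ← hv]
    rw [h2, map_smul, hqq]
  have hxK : x ∉ K := by rw [← hq, hqx]; exact hx
  obtain ⟨l, hl, hlx⟩ := exists_functional hxK
  have hlq : ∀ b, l b = l (q b) := fun b => by
    have : b - q b ∈ K := by rw [← hq, map_sub, hqq, sub_self]
    have := hl _ this
    rwa [map_sub, sub_eq_zero] at this
  have hclass : ∀ b, normalize (q b) = x → l b ≠ 0 ∧ b ∈ K ⊔ Submodule.span F {x} := by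
    intro b hb
    obtain ⟨c, hc, hv⟩ := exists_eq_smul_normalize (q b)
    rw [hb] at hv
    refine ⟨by rw [hlq, hv, map_smul, hlx]; simpa using hc, ?_⟩
    rw [← sub_add_cancel b (q b)]
    refine Submodule.add_mem_sup (by rw [← hq, map_sub, hqq, sub_self]) ?_
    rw [hv]
    exact Submodule.smul_mem _ _ (Submodule.mem_span_singleton_self x)
  have hnot : ∀ b, q b ≠ 0 → normalize (q b) ≠ x → b ∉ K ⊔ Submodule.span F {x} := by
    intro b hb hb' hmem
    obtain ⟨y, hy, z, hz, rfl⟩ := Submodule.mem_sup.1 hmem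
    obtain ⟨c, rfl⟩ := Submodule.mem_span_singleton.1 hz
    rw [map_add, (hq y).2 hy, zero_add, map_smul, hqx] at hb hb'
    have hc : c ≠ 0 := fun hc => hb (by simp [hc])
    obtain ⟨c₀, hc₀, hv⟩ := exists_eq_smul_normalize (q (a j₀))
    rw [(Finset.mem_filter.1 hj₀).2] at hv
    apply hb'
    rw [normalize_smul hc, ← normalize_smul hc₀, ← hv]
    exact (Finset.mem_filter.1 hj₀).2
  set N := Finset.univ.filter fun j => q (a' j) = 0
  set O := Finset.univ.filter fun j => q (a' j) ≠ 0 ∧ normalize (q (a' j)) ≠ x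
  have hsplit : ∏ j, linForm (a' j) = (∏ j ∈ O, linForm (a' j)) *
      ((∏ j ∈ N, linForm (a' j)) * ∏ j ∈ B', linForm (a' j)) := by
    rw [← Finset.prod_filter_mul_prod_filter_not Finset.univ (fun j => q (a' j) = 0),
      ← Finset.prod_filter_mul_prod_filter_not (Finset.univ.filter fun j => ¬ q (a' j) = 0)
        (fun j => normalize (q (a' j)) = x), Finset.filter_filter, Finset.filter_filter]
    have : (Finset.univ.filter fun j => ¬ q (a' j) = 0 ∧ normalize (q (a' j)) = x) = B' := by
      refine Finset.filter_congr fun j _ => ⟨fun h => h.2, fun h => ⟨fun h0 => hx ?_, h⟩⟩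
      rw [← h, normalize_eq_zero.2 h0]
    rw [this]
    ring
  have hI₁ : Based (K ⊔ Submodule.span F {x}) (I ⊔ Ideal.span {∏ j ∈ B, linForm (a j)}) :=
    h.sup_span_prod le_sup_left fun j hj => (hclass _ (Finset.mem_filter.1 hj).2).2
  have hNI : ∏ j ∈ N, linForm (a' j) ∉ I := fun hN =>
    ha' (by rw [hsplit]; exact Ideal.mul_mem_left _ _ (Ideal.mul_mem_right _ _ hN))
  rw [hsplit] at hmem
  have hmem' := hI₁.mem_of_prod_mul_mem (fun j hj => hnot _ (Finset.mem_filter.1 hj).2.1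
    (Finset.mem_filter.1 hj).2.2) hmem
  obtain ⟨y, hy, z, hz, hyz⟩ := Submodule.mem_sup.1 hmem'
  obtain ⟨w, rfl⟩ := Ideal.mem_span_singleton'.1 hz
  have hdiff : (∏ j ∈ N, linForm (a' j)) * (∏ j ∈ B', linForm (a' j)) -
      w * ∏ j ∈ B, linForm (a j) ∈ I := by
    rw [← hyz, add_sub_cancel_right]; exact hy
  have h1 := h.translate_mem hl hdiff
  rw [mem_map_C_iff_map_mk, map_sub, Polynomial.map_sub, sub_eq_zero, map_mul, map_mul,
    translate_prod_eq (fun j hj => hl _ ((hq _).1 (Finset.mem_filter.1 hj).2)),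
    Polynomial.map_mul, Polynomial.map_mul, Polynomial.map_C] at h1
  set π := Ideal.Quotient.mk I
  set P := (translate l (∏ j ∈ B, linForm (a j))).map π with hP
  set P' := (translate l (∏ j ∈ B', linForm (a' j))).map π with hP'
  set W := (translate l w).map π
  have hunit : ∀ c : F, c ≠ 0 → IsUnit (π (C c)) := fun c hc =>
    ((IsUnit.mk0 c hc).map C).map π
  have hPc : P.coeff B.card = π (C (∏ j ∈ B, l (a j))) := by
    rw [hP, Polynomial.coeff_map, coeff_card_translate_prod]
  have hPc' : P'.coeff B'.card = π (C (∏ j ∈ B', l (a' j))) := by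
    rw [hP', Polynomial.coeff_map, coeff_card_translate_prod]
  have hPd : P.natDegree ≤ B.card :=
    Polynomial.natDegree_map_le.trans (natDegree_translate_prod_le l B a)
  have hPd' : P'.natDegree ≤ B'.card :=
    Polynomial.natDegree_map_le.trans (natDegree_translate_prod_le l B' a')
  have hne : W ≠ 0 := by
    intro hW
    have h2 := congrArg (fun p => p.coeff B'.card) h1
    simp only [hW, zero_mul, Polynomial.coeff_C_mul, Polynomial.coeff_zero] at h2
    rw [hPc', (hunit _ (Finset.prod_ne_zero_iff.2 fun j hj =>
      (hclass _ (Finset.mem_filter.1 hj).2).1)).mul_left_eq_zero] at h2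
    exact hNI (Ideal.Quotient.eq_zero_iff_mem.1 h2)
  have hcoeff : (W * P).coeff (W.natDegree + B.card) ≠ 0 := by
    rw [Polynomial.coeff_mul_add_eq_of_natDegree_le le_rfl hPd, hPc]
    rw [Ne, (hunit _ (Finset.prod_ne_zero_iff.2 fun j hj =>
      (hclass _ (Finset.mem_filter.1 hj).2).1)).mul_left_eq_zero]
    exact Polynomial.leadingCoeff_ne_zero.2 hne
  have h3 := Polynomial.le_natDegree_of_ne_zero hcoeff
  rw [← h1] at h3
  have h4 := h3.trans ((Polynomial.natDegree_C_mul_le _ _).trans hPd')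
  omega

/-- The two families agree modulo `K`, up to order and nonzero scalars. -/
def Matched (K : Submodule F (Fin n → F)) {d : ℕ} (a a' : Fin d → Fin n → F) : Prop :=
  ∃ (σ : Equiv.Perm (Fin d)) (c : Fin d → F), ∀ j, c j ≠ 0 ∧ a' (σ j) - c j • a j ∈ K

lemma Matched.refl (K : Submodule F (Fin n → F)) {d : ℕ} (a : Fin d → Fin n → F) :
    Matched K a a :=
  ⟨1, 1, fun j => by simp⟩

lemma Matched.mono {K K' : Submodule F (Fin n → F)} (hK : K ≤ K') {d : ℕ}
    {a a' : Fin d → Fin n → F} (h : Matched K a a') : Matched K' a a' := by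
  obtain ⟨σ, c, h⟩ := h
  exact ⟨σ, c, fun j => ⟨(h j).1, hK (h j).2⟩⟩

lemma Matched.trans {K : Submodule F (Fin n → F)} {d : ℕ} {a a' a'' : Fin d → Fin n → F}
    (h : Matched K a a') (h' : Matched K a' a'') : Matched K a a'' := by
  obtain ⟨σ, c, h⟩ := h
  obtain ⟨σ', c', h'⟩ := h'
  refine ⟨σ.trans σ', fun j => c' (σ j) * c j, fun j =>
    ⟨mul_ne_zero (h' _).1 (h j).1, ?_⟩⟩
  have := K.add_mem (h' (σ j)).2 (K.smul_mem (c' (σ j)) (h j).2)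
  rwa [smul_sub, sub_add_sub_cancel, ← mul_smul] at this

/-- Two products of linear forms that agree up to a scalar modulo an ideal based on `K`, without
vanishing there, are matched modulo `K`. -/
lemma Based.matched {K : Submodule F (Fin n → F)} {I : Ideal (MvPolynomial (Fin n) F)}
    (h : Based K I) {d : ℕ} {a a' : Fin d → Fin n → F} {c : F}
    (hc : ∏ j, linForm (a j) - C c * ∏ j, linForm (a' j) ∈ I) (ha : ∏ j, linForm (a j) ∉ I) :
    Matched K a a' := by
  classical
  obtain ⟨q, hq, hqq⟩ := exists_projection K
  have hc0 : c ≠ 0 := by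
    rintro rfl
    exact ha (by simpa using hc)
  have ha' : ∏ j, linForm (a' j) ∉ I := fun hmem =>
    ha ((Submodule.sub_mem_iff_left _ (Ideal.mul_mem_left _ _ hmem)).1 hc)
  have hdvd : ∀ (b : Fin d → Fin n → F) (x : Fin n → F),
      ∏ j, linForm (b j) ∈ Ideal.span {∏ j with normalize (q (b j)) = x, linForm (b j)} :=
    fun b x => Ideal.mem_span_singleton.2
      (Finset.prod_dvd_prod_of_subset _ _ _ (Finset.subset_univ _))
  have hcount : ∀ x ≠ 0, (Finset.univ.filter fun j => normalize (q (a j)) = x).card =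
      (Finset.univ.filter fun j => normalize (q (a' j)) = x).card := by
    intro x hx
    refine le_antisymm (h.card_class_le hq hqq a a' hx ha' ?_)
      (h.card_class_le hq hqq a' a hx ha ?_)
    · have h1 : C c * ∏ j, linForm (a' j) ∈ I ⊔
          Ideal.span {∏ j with normalize (q (a j)) = x, linForm (a j)} :=
        (Submodule.sub_mem_iff_right _ (Ideal.mem_sup_right (hdvd a x))).1 (Ideal.mem_sup_left hc)
      have h2 := Ideal.mul_mem_left _ (C c⁻¹) h1
      rwa [← mul_assoc, ← map_mul, inv_mul_cancel₀ hc0, map_one, one_mul] at h2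
    · exact (Submodule.sub_mem_iff_left _ (Ideal.mem_sup_right
        (Ideal.mul_mem_left _ _ (hdvd a' x)))).1 (Ideal.mem_sup_left hc)
  obtain ⟨σ, hσ⟩ := exists_perm_of_card_fiber_eq (fun j => normalize (q (a j)))
    (fun j => normalize (q (a' j))) 0 hcount
  choose e he using fun j => exists_eq_smul_of_normalize_eq (hσ j).symm
  refine ⟨σ, e, fun j => ⟨(he j).1, ?_⟩⟩
  rw [← hq, map_sub, map_smul, (he j).2, sub_self]

/-- The terms of a minimal identity are pairwise matched modulo a subspace of small rank. -/
lemma Circuit.exists_matched {k d : ℕ} (T : Circuit F n k d) (hid : T.IsIdentity)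
    (hmin : T.IsMinimal) (i₀ : Fin k) :
    ∃ K : Submodule F (Fin n → F), Module.finrank F K ≤ k ^ 2 ∧
      ∀ i, Matched K (T.form i₀) (T.form i) := by
  classical
  -- The set of terms matched with `i₀` grows by one term at a time, each costing at most `k`
  -- dimensions.
  have key : ∀ m, m + 1 ≤ k → ∃ (A : Finset (Fin k)) (K : Submodule F (Fin n → F)),
      A.card = m + 1 ∧ i₀ ∈ A ∧ Module.finrank F K ≤ m * k ∧
        ∀ i ∈ A, Matched K (T.form i₀) (T.form i) := by
    intro m
    induction m with
    | zero =>
      intro _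
      exact ⟨{i₀}, ⊥, by simp, by simp, by simp, by simp [Matched.refl]⟩
    | succ m ih =>
      intro hm
      obtain ⟨A, K, hcard, hi₀, hK, hA⟩ := ih (by omega)
      have hAu : A ≠ Finset.univ := by
        rintro rfl
        rw [Finset.card_univ, Fintype.card_fin] at hcard
        omega
      have hsum := hmin A ⟨i₀, hi₀⟩ hAu
      have hcompl : ∑ i ∈ A, T.term i + ∑ i ∈ Aᶜ, T.term i = 0 := by
        rw [Finset.sum_add_sum_compl]; exact hid
      have hccard : A.card + Aᶜ.card = k := by
        rw [Finset.card_add_card_compl, Fintype.card_fin]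
      obtain ⟨K₁, I₁, hB₁, -, -, hr₁, hne₁, i₁, hi₁, c₁, hc₁⟩ :=
        (based_bot (⊥ : Submodule F (Fin n → F))).exists_certificate T.form T.coeff A
          (by rwa [Ideal.mem_bot])
      -- The complementary sum is minus the first one, so it is still nonzero modulo `I₁`; the
      -- second certificate refines the first.
      obtain ⟨K₂, I₂, hB₂, -, hI₂, hr₂, hne₂, i₂, hi₂, c₂, hc₂⟩ :=
        hB₁.exists_certificate T.form T.coeff Aᶜ (fun hmem => hne₁ (by
          change ∑ i ∈ A, T.term i ∈ I₁
          rw [eq_neg_of_add_eq_zero_left hcompl]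
          exact I₁.neg_mem hmem))
      rw [finrank_bot, zero_add] at hr₁
      change ∑ i ∈ A, T.term i - _ ∈ I₁ at hc₁
      change ∑ i ∈ Aᶜ, T.term i - _ ∈ I₂ at hc₂
      change ∑ i ∈ Aᶜ, T.term i ∉ I₂ at hne₂
      have hadd : C c₁ * ∏ j, linForm (T.form i₁ j) + C c₂ * ∏ j, linForm (T.form i₂ j) ∈ I₂ := by
        have h1 := I₂.neg_mem (I₂.add_mem (hI₂ hc₁) hc₂)
        convert h1 using 1
        linear_combination hcompl
      have hnot : C c₁ * ∏ j, linForm (T.form i₁ j) ∉ I₂ := fun hmem => hne₂ (by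
        have h1 := (Submodule.add_mem_iff_right _ hmem).1 hadd
        exact (Submodule.sub_mem_iff_left _ h1).1 hc₂)
      have hc₁0 : c₁ ≠ 0 := by
        rintro rfl
        simp at hnot
      have hmatch : Matched K₂ (T.form i₁) (T.form i₂) := by
        refine hB₂.matched (c := -(c₁⁻¹ * c₂)) ?_ fun hmem => hnot (Ideal.mul_mem_left _ _ hmem)
        have h1 := Ideal.mul_mem_left _ (C c₁⁻¹) hadd
        convert h1 using 1
        rw [mul_add, ← mul_assoc, ← mul_assoc, ← map_mul, ← map_mul, inv_mul_cancel₀ hc₁0,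
          map_neg, map_one]
        ring
      have hi₂' := Finset.mem_compl.1 hi₂
      refine ⟨insert i₂ A, K ⊔ K₂, ?_, Finset.mem_insert_of_mem hi₀, ?_, ?_⟩
      · rw [Finset.card_insert_of_notMem hi₂', hcard]
      · have h1 := Submodule.finrank_add_le_finrank_add_finrank K K₂
        have h2 : (m + 1) * k = m * k + k := by ring
        omega
      · intro i hi
        rcases Finset.mem_insert.1 hi with rfl | hi
        · exact ((hA i₁ hi₁).mono le_sup_left).trans (hmatch.mono le_sup_right)
        · exact (hA i hi).mono le_sup_left
  have hk : 0 < k := i₀.pos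
  obtain ⟨A, K, hcard, -, hK, hA⟩ := key (k - 1) (by omega)
  have hAu : A = Finset.univ := Finset.eq_univ_of_card A (by
    rw [hcard, Fintype.card_fin]; omega)
  refine ⟨K, hK.trans ?_, fun i => hA i (by simp [hAu])⟩
  rw [sq]
  exact Nat.mul_le_mul_right k (Nat.sub_le k 1)

end Matching

/-! ### Enlarging the subspace to make the inner parts independent -/

section Nucleus

variable {F : Type*} [Field F] {n : ℕ}

/-- Matched terms can be rewritten so that corresponding forms differ by elements of `K`. -/
lemma Circuit.exists_aligned {k d : ℕ} (T : Circuit F n k d) {K : Submodule F (Fin n → F)}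
    {i₀ : Fin k} (h : ∀ i, Matched K (T.form i₀) (T.form i)) :
    ∃ (a : Fin k → Fin d → Fin n → F) (b : Fin k → F) (r : Fin d → Fin n → F),
      (∀ i, T.term i = C (b i) * ∏ j, linForm (a i j)) ∧ (∀ i, b i ≠ 0) ∧ (∀ i j, a i j ≠ 0) ∧
      (∀ i j, a i j - r j ∈ K) ∧ ∀ i j, ∃ (j' : Fin d) (c : F), T.form i j = c • a i j' := by
  choose σ c h using h
  refine ⟨fun i j => (c i j)⁻¹ • T.form i (σ i j), fun i => T.coeff i * ∏ j, c i j, T.form i₀,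
    fun i => ?_, fun i => ?_, fun i j => ?_, fun i j => ?_, fun i j => ?_⟩
  · rw [Circuit.term, ← Equiv.prod_comp (σ i)]
    simp only [linForm_smul, Finset.prod_mul_distrib, map_mul, map_prod]
    have : (∏ j, C (c i j)) * ∏ j, C (c i j)⁻¹ = (1 : MvPolynomial (Fin n) F) := by
      rw [← Finset.prod_mul_distrib]
      refine Finset.prod_eq_one fun j _ => ?_
      rw [← map_mul, mul_inv_cancel₀ (h i j).1, map_one]
    rw [mul_assoc, ← mul_assoc (∏ j, C (c i j)), this, one_mul]
  · exact mul_ne_zero (T.coeff_ne_zero i) (Finset.prod_ne_zero_iff.2 fun j _ => (h i j).1)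
  · exact smul_ne_zero (inv_ne_zero (h i j).1) (T.form_ne_zero _ _)
  · have := K.smul_mem (c i j)⁻¹ (h i j).2
    rwa [smul_sub, inv_smul_smul₀ (h i j).1] at this
  · refine ⟨(σ i).symm j, c i ((σ i).symm j), ?_⟩
    simp only [Equiv.apply_symm_apply]
    rw [smul_inv_smul₀ (h i _).1]

open scoped Classical in
/-- The product of the forms of a family lying in `K`, where `r` is a reference family. -/
def innerPart (K : Submodule F (Fin n → F)) {d : ℕ} (r a : Fin d → Fin n → F) :
    MvPolynomial (Fin n) F :=
  ∏ j with r j ∈ K, linForm (a j)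

open scoped Classical in
-- Aligned forms have the same image under `q`, so the factor coming from outside `K` depends only
-- on `r`. Being common to all terms, it can be cancelled from relations.
lemma coeff_spread_prod {K : Submodule F (Fin n → F)} {q : (Fin n → F) →ₗ[F] (Fin n → F)}
    (hq : ∀ a, q a = 0 ↔ a ∈ K) {ι : Type*} (t : Finset ι) {r a : ι → Fin n → F}
    (h : ∀ j ∈ t, a j - r j ∈ K) :
    (spread q (∏ j ∈ t, linForm (a j))).coeff (t.filter fun j => r j ∉ K).card =
      (∏ j ∈ t with r j ∈ K, linForm (a j)) * ∏ j ∈ t with r j ∉ K, linForm (q (r j)) := by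
  have hqa : ∀ j ∈ t, q (a j) = q (r j) := fun j hj => by
    rw [← sub_eq_zero, ← map_sub, hq]; exact h j hj
  have := coeff_prod_pencil (t.filter fun j => r j ∈ K) t (Finset.filter_subset _ _)
    (fun j => linForm (a j - q (a j))) (fun j => linForm (q (a j))) (fun j hj => by
      rw [hqa j (Finset.mem_filter.1 hj).1, (hq _).2 (Finset.mem_filter.1 hj).2, linForm_zero])
  rw [map_prod]
  simp only [spread_linForm]
  rw [Finset.filter_not, this]
  congr 1
  · refine Finset.prod_congr rfl fun j hj => ?_
    rw [hqa j (Finset.mem_filter.1 hj).1, (hq _).2 (Finset.mem_filter.1 hj).2, sub_zero]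
  · exact Finset.prod_congr rfl fun j hj => by rw [hqa j (Finset.mem_sdiff.1 hj).1]

lemma prod_linForm_ne_zero {ι : Type*} {t : Finset ι} {a : ι → Fin n → F}
    (h : ∀ j ∈ t, a j ≠ 0) : ∏ j ∈ t, linForm (a j) ≠ 0 :=
  Finset.prod_ne_zero_iff.2 fun j hj => linForm_eq_zero.not.2 (h j hj)

/-- The coefficient of `spread q` counting forms outside `K` turns one relation into the other times
a common nonzero factor. Thus relation spaces shrink as the subspace grows. -/
lemma innerPart_relation_mono {K K' : Submodule F (Fin n → F)} (hK : K ≤ K') {d : ℕ} {ι : Type*}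
    [Fintype ι] {a : ι → Fin d → Fin n → F} {r : Fin d → Fin n → F}
    (h : ∀ i j, a i j - r j ∈ K) {β : ι → F}
    (hβ : ∑ i, β i • innerPart K' r (a i) = 0) : ∑ i, β i • innerPart K r (a i) = 0 := by
  classical
  obtain ⟨q, hq, -⟩ := exists_projection K
  set t := Finset.univ.filter fun j => r j ∈ K'
  have h1 := congrArg (fun p => (spread q p).coeff (t.filter fun j => r j ∉ K).card) hβ
  simp only [map_sum, map_smul, map_zero, Polynomial.coeff_zero, Polynomial.finsetSum_coeff,
    Polynomial.coeff_smul] at h1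
  have h2 : ∀ i, (spread q (innerPart K' r (a i))).coeff (t.filter fun j => r j ∉ K).card =
      innerPart K r (a i) * ∏ j ∈ t with r j ∉ K, linForm (q (r j)) := fun i => by
    rw [innerPart, coeff_spread_prod hq t fun j _ => h i j, innerPart, Finset.filter_filter]
    congr 2
    exact Finset.filter_congr fun j _ => ⟨fun h => h.2, fun h => ⟨hK h, h⟩⟩
  simp only [h2, ← smul_mul_assoc] at h1
  rw [← Finset.sum_mul] at h1
  refine (mul_eq_zero.1 h1).resolve_right (prod_linForm_ne_zero fun j hj => ?_)
  rw [Ne, hq]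
  exact (Finset.mem_filter.1 hj).2

/-- A relation between inner parts is destroyed by enlarging `K` by a small amount, if the
full products are independent. -/
lemma exists_not_innerPart_relation (K : Submodule F (Fin n → F)) {d : ℕ} {ι : Type*}
    [Fintype ι] {a : ι → Fin d → Fin n → F} {r : Fin d → Fin n → F}
    (h : ∀ i j, a i j - r j ∈ K) (hind : LinearIndependent F fun i => ∏ j, linForm (a i j))
    {β : ι → F} (hβ : β ≠ 0) :
    ∃ K', K ≤ K' ∧ Module.finrank F K' ≤ Module.finrank F K + Fintype.card ι ∧
      ∑ i, β i • innerPart K' r (a i) ≠ 0 := by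
  classical
  have hf : ∑ i, C (β i) * ∏ j, linForm (a i j) ∉ (⊥ : Ideal (MvPolynomial (Fin n) F)) := by
    rw [Ideal.mem_bot]
    intro h0
    refine hβ (funext (Fintype.linearIndependent_iff.1 hind β ?_))
    simpa only [smul_eq_C_mul] using h0
  obtain ⟨K₁, I, hB, -, -, hr, hne, i₁, -, c, hc⟩ :=
    (based_bot (⊥ : Submodule F (Fin n → F))).exists_certificate a β Finset.univ hf
  refine ⟨K ⊔ K₁, le_sup_left, ?_, fun h0 => hne ?_⟩
  · have h1 := Submodule.finrank_add_le_finrank_add_finrank K K₁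
    rw [finrank_bot, zero_add, Finset.card_univ] at hr
    omega
  set K' := K ⊔ K₁
  have hB' : Based K' I := hB.mono le_sup_right
  have h' : ∀ i j, a i j - r j ∈ K' := fun i j => (le_sup_left : K ≤ K') (h i j)
  obtain ⟨q, hq, hqq⟩ := exists_projection K'
  have hcoeff : ∀ i, (spread q (∏ j, linForm (a i j))).coeff
      (Finset.univ.filter fun j => r j ∉ K').card =
      innerPart K' r (a i) * ∏ j with r j ∉ K', linForm (q (r j)) := fun i =>
    coeff_spread_prod hq Finset.univ fun j _ => h' i j
  -- If the relation persisted, this coefficient would leave `c` times the inner part of `i₁` times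
  -- forms outside `K'`. Cancelling those puts `c` times the term `i₁`, hence the whole sum, in `I`.
  have h1 := hB'.coeff_spread_mem (fun a ha => (hq a).2 ha) hc
    (Finset.univ.filter fun j => r j ∉ K').card
  simp only [← smul_eq_C_mul] at h1 ⊢
  simp only [map_sub, map_sum, map_smul, Polynomial.coeff_sub, Polynomial.finsetSum_coeff,
    Polynomial.coeff_smul, hcoeff, ← smul_mul_assoc] at h1
  rw [← Finset.sum_mul, h0, zero_mul, zero_sub, neg_mem_iff, mul_comm] at h1
  have h2 := hB'.mem_of_prod_mul_mem (fun j hj => by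
    rw [← hq, hqq, hq]; exact (Finset.mem_filter.1 hj).2) h1
  have h3 : c • ∏ j, linForm (a i₁ j) ∈ I := by
    rw [← Finset.prod_filter_mul_prod_filter_not Finset.univ (fun j => r j ∈ K'),
      ← smul_mul_assoc]
    exact Ideal.mul_mem_right _ _ h2
  simp only [← smul_eq_C_mul] at hc
  exact (Submodule.sub_mem_iff_left _ h3).1 hc

/-- Enlarging `K` by a small amount makes the inner parts of independent products independent. -/
lemma exists_linearIndependent_innerPart (K : Submodule F (Fin n → F)) {d : ℕ} {ι : Type*}
    [Fintype ι] {a : ι → Fin d → Fin n → F} {r : Fin d → Fin n → F}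
    (h : ∀ i j, a i j - r j ∈ K) (hind : LinearIndependent F fun i => ∏ j, linForm (a i j)) :
    ∃ K', K ≤ K' ∧ Module.finrank F K' ≤ Module.finrank F K + Fintype.card ι ^ 2 ∧
      LinearIndependent F fun i => innerPart K' r (a i) := by
  classical
  let V : Submodule F (Fin n → F) → Submodule F (ι → F) := fun K =>
    LinearMap.ker (Fintype.linearCombination F fun i => innerPart K r (a i))
  have hV : ∀ K β, β ∈ V K ↔ ∑ i, β i • innerPart K r (a i) = 0 := fun K β => by
    simp [V, Fintype.linearCombination_apply]
  -- Every enlargement strictly lowers the dimension of the relation space, at most `Fintype.card ι`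
  -- at the start.
  have key : ∀ m K, (∀ i j, a i j - r j ∈ K) → Module.finrank F (V K) = m →
      ∃ K', K ≤ K' ∧ Module.finrank F K' ≤ Module.finrank F K + m * Fintype.card ι ∧
        V K' = ⊥ := by
    intro m
    induction m using Nat.strong_induction_on with
    | _ m ih =>
    intro K h hm
    by_cases hbot : V K = ⊥
    · exact ⟨K, le_rfl, Nat.le_add_right _ _, hbot⟩
    obtain ⟨β, hβ, hβ0⟩ := Submodule.exists_mem_ne_zero_of_ne_bot hbot
    obtain ⟨K₁, hK₁, hr₁, hne⟩ := exists_not_innerPart_relation K h hind hβ0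
    have hlt : V K₁ < V K := by
      refine lt_of_le_of_ne (fun γ hγ => ?_) fun heq => ?_
      · rw [hV] at hγ ⊢
        exact innerPart_relation_mono hK₁ h hγ
      · rw [← heq, hV] at hβ
        exact hne hβ
    have hfin := Submodule.finrank_lt_finrank_of_lt hlt
    rw [hm] at hfin
    obtain ⟨K', hK', hr', hbot'⟩ := ih _ hfin K₁ (fun i j => hK₁ (h i j)) rfl
    refine ⟨K', hK₁.trans hK', ?_, hbot'⟩
    have : (Module.finrank F (V K₁) + 1) * Fintype.card ι ≤ m * Fintype.card ι :=
      Nat.mul_le_mul_right _ hfin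
    rw [add_mul, one_mul] at this
    omega
  obtain ⟨K', hK', hr', hbot⟩ := key _ K h rfl
  refine ⟨K', hK', hr'.trans ?_, ?_⟩
  · have h1 := Submodule.finrank_le (V K)
    rw [Module.finrank_fintype_fun_eq_card] at h1
    rw [sq]
    exact Nat.add_le_add_left (Nat.mul_le_mul_right _ h1) _
  · rw [Fintype.linearIndependent_iff]
    intro β hβ i
    have : β ∈ V K' := (hV K' β).2 hβ
    rw [hbot, Submodule.mem_bot] at this
    rw [this]; rfl

end Nucleus

/-! ### Varying classes form Sylvester-Gallai closed sets -/

section Closure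

/-- Let `W U'` be spanned by the products over subsets of `U'`; `x` is orthogonal to it. If adding
`s` does not enlarge `W U'`, this space is stable under multiplication by `θ s`, so it contains the
indicator of a level set of `θ s`, over which `x` then sums to zero. Otherwise the dimension grows
each time, `W U` is everything, and `x = 0`. -/
lemma exists_subset_sum_eq_zero_of_orthogonal {L ι κ : Type*} [Field L] [Fintype ι] (U : Finset κ)
    (x : ι → L) (θ : κ → ι → L) (hθ : ∀ s ∈ U, ∃ i i', θ s i ≠ θ s i')
    (hcard : Fintype.card ι ≤ U.card + 1) (hι : 2 ≤ Fintype.card ι)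
    (h : ∀ B ⊆ U, ∑ i, x i * ∏ s ∈ B, θ s i = 0) :
    ∃ A : Finset ι, A.Nonempty ∧ A ≠ Finset.univ ∧ ∑ i ∈ A, x i = 0 := by
  classical
  by_contra! hno
  let W : Finset κ → Submodule L (ι → L) := fun U' =>
    Submodule.span L ((fun B : Finset κ => ∏ s ∈ B, θ s) '' {B | B ⊆ U'})
  have hgen : ∀ {U' B : Finset κ}, B ⊆ U' → ∏ s ∈ B, θ s ∈ W U' := fun hB =>
    Submodule.subset_span (Set.mem_image_of_mem _ hB)
  have horth : ∀ U' ⊆ U, ∀ w ∈ W U', ∑ i, x i * w i = 0 := by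
    intro U' hU' w hw
    induction hw using Submodule.span_induction with
    | mem w hw =>
      obtain ⟨B, hB, rfl⟩ := hw
      simpa [Finset.prod_apply] using h B (hB.trans hU')
    | zero => simp
    | add v w _ _ hv hw => simp [mul_add, Finset.sum_add_distrib, hv, hw]
    | smul c v _ hv =>
      simp only [Pi.smul_apply, smul_eq_mul, mul_left_comm _ c, ← Finset.mul_sum, hv, mul_zero]
  have hdim : ∀ U' ⊆ U, U'.card + 1 ≤ Module.finrank L (W U') := by
    intro U'
    induction U' using Finset.induction_on with
    | empty =>
      intro _
      have h1 : (1 : ι → L) ∈ W ∅ := by simpa using hgen (Finset.Subset.refl ∅)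
      have : Nonempty ι := Fintype.card_pos_iff.1 (by omega)
      rw [Finset.card_empty, zero_add, Submodule.one_le_finrank_iff]
      intro hbot
      rw [hbot, Submodule.mem_bot] at h1
      exact one_ne_zero h1
    | insert s U' hs ih =>
      intro hU'
      have hsub : U' ⊆ U := (Finset.subset_insert s U').trans hU'
      have hle : W U' ≤ W (insert s U') :=
        Submodule.span_mono (Set.image_mono fun B hB => hB.trans (Finset.subset_insert s U'))
      have hne : W U' ≠ W (insert s U') := by
        intro heq
        have hmul : ∀ w ∈ W U', θ s * w ∈ W U' := by
          intro w hw
          induction hw using Submodule.span_induction with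
          | mem w hw =>
            obtain ⟨B, hB, rfl⟩ := hw
            have hsB : s ∉ B := fun hsB => hs (hB hsB)
            have h1 := hgen (Finset.insert_subset_insert s hB)
            rwa [Finset.prod_insert hsB, ← heq] at h1
          | zero => simp
          | add v w _ _ hv hw => rw [mul_add]; exact add_mem hv hw
          | smul c v _ hv => rw [mul_smul_comm]; exact Submodule.smul_mem _ _ hv
        obtain ⟨i, i', hii'⟩ := hθ s (hU' (Finset.mem_insert_self s U'))
        -- Lagrange interpolation: with `Q = Aᶜ` this vanishes off the level set `A` and is a
        -- nonzero constant on it.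
        have hprod : ∀ Q : Finset ι, ∏ e ∈ Q, (θ s - fun _ => θ s e) ∈ W U' := by
          intro Q
          induction Q using Finset.induction_on with
          | empty => simpa using hgen (Finset.empty_subset U')
          | insert e Q he ih =>
            rw [Finset.prod_insert he, sub_mul]
            exact sub_mem (hmul _ ih) (Submodule.smul_mem _ (θ s e) ih)
        set A := Finset.univ.filter fun e => θ s e = θ s i
        have h1 := horth U' hsub _ (hprod Aᶜ)
        have h2 : ∀ e, x e * (∏ e' ∈ Aᶜ, (θ s - fun _ => θ s e') : ι → L) e =
            if e ∈ A then x e * ∏ e' ∈ Aᶜ, (θ s i - θ s e') else 0 := by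
          intro e
          rw [Finset.prod_apply]
          split_ifs with he
          · simp only [Pi.sub_apply, (Finset.mem_filter.1 he).2]
          · rw [Finset.prod_eq_zero (Finset.mem_compl.2 he) (by simp), mul_zero]
        simp only [h2, Finset.sum_ite_mem, Finset.univ_inter, ← Finset.sum_mul] at h1
        refine hno A ⟨i, by simp [A]⟩ (fun hA => ?_) ((mul_eq_zero.1 h1).resolve_right ?_)
        · have : i' ∈ A := hA ▸ Finset.mem_univ i'
          exact hii' (Finset.mem_filter.1 this).2.symm
        · refine Finset.prod_ne_zero_iff.2 fun e he => sub_ne_zero.2 fun h => ?_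
          exact Finset.mem_compl.1 he (by simp [A, h])
      have := Submodule.finrank_lt_finrank_of_lt (lt_of_le_of_ne hle hne)
      have := ih hsub
      rw [Finset.card_insert_of_notMem hs]
      omega
  have htop : W U = ⊤ := by
    refine Submodule.eq_top_of_finrank_eq (le_antisymm (Submodule.finrank_le _) ?_)
    rw [Module.finrank_fintype_fun_eq_card]
    exact hcard.trans (hdim U subset_rfl)
  obtain ⟨i⟩ : Nonempty ι := Fintype.card_pos_iff.1 (by omega)
  refine hno {i} ⟨i, by simp⟩ (fun hi => ?_) ?_
  · have := congrArg Finset.card hi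
    rw [Finset.card_singleton, Finset.card_univ] at this
    omega
  · have := horth U subset_rfl (Pi.single i 1) (by rw [htop]; trivial)
    simpa [Pi.single_apply] using this

variable {F : Type*} [Field F] {n : ℕ}

open scoped Classical in
/-- The product of the forms whose reference form has class `x` modulo the kernel of `q`. -/
def node (q : (Fin n → F) →ₗ[F] (Fin n → F)) {d : ℕ} (r a : Fin d → Fin n → F)
    (x : Fin n → F) : MvPolynomial (Fin n) F :=
  ∏ j with normalize (q (r j)) = x, linForm (a j)

open scoped Classical in
lemma prod_node (q : (Fin n → F) →ₗ[F] (Fin n → F)) {d : ℕ} (r a : Fin d → Fin n → F)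
    (U : Finset (Fin n → F)) :
    ∏ x ∈ U, node q r a x = ∏ j with normalize (q (r j)) ∈ U, linForm (a j) := by
  rw [← Finset.prod_fiberwise_of_maps_to (t := U) (g := fun j => normalize (q (r j)))
    (fun j hj => (Finset.mem_filter.1 hj).2)]
  refine Finset.prod_congr rfl fun x hx => ?_
  rw [node, Finset.filter_filter]
  congr 1
  exact Finset.filter_congr fun j _ => ⟨fun h => ⟨h ▸ hx, h⟩, fun h => h.2⟩

open scoped Classical in
lemma innerPart_eq_node {K : Submodule F (Fin n → F)} {q : (Fin n → F) →ₗ[F] (Fin n → F)}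
    (hq : ∀ a, q a = 0 ↔ a ∈ K) {d : ℕ} (r a : Fin d → Fin n → F) :
    innerPart K r a = node q r a 0 := by
  rw [innerPart, node]
  congr 1
  exact Finset.filter_congr fun j _ => by rw [normalize_eq_zero, hq]

lemma node_ne_zero (q : (Fin n → F) →ₗ[F] (Fin n → F)) {d : ℕ} (r : Fin d → Fin n → F)
    {a : Fin d → Fin n → F} (ha : ∀ j, a j ≠ 0) (x : Fin n → F) : node q r a x ≠ 0 :=
  prod_linForm_ne_zero fun j _ => ha j

open scoped Classical in
/-- The classes outside the kernel of `q` whose node is not the same in all terms. -/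
def varyingClasses {ι : Type*} (q : (Fin n → F) →ₗ[F] (Fin n → F)) {d : ℕ}
    (r : Fin d → Fin n → F) (a : ι → Fin d → Fin n → F) : Finset (Fin n → F) :=
  (Finset.univ.image fun j => normalize (q (r j))).filter fun x =>
    x ≠ 0 ∧ ∃ i i', node q r (a i) x ≠ node q r (a i') x

lemma mem_varyingClasses {ι : Type*} {q : (Fin n → F) →ₗ[F] (Fin n → F)} {d : ℕ}
    {r : Fin d → Fin n → F} {a : ι → Fin d → Fin n → F} {x : Fin n → F} :
    x ∈ varyingClasses q r a ↔ (∃ j, normalize (q (r j)) = x) ∧ x ≠ 0 ∧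
      ∃ i i', node q r (a i) x ≠ node q r (a i') x := by
  simp [varyingClasses]

open scoped Classical in
lemma card_varyingClasses_le {ι : Type*} (q : (Fin n → F) →ₗ[F] (Fin n → F)) {d : ℕ}
    (r : Fin d → Fin n → F) (a : ι → Fin d → Fin n → F) : (varyingClasses q r a).card ≤ d :=
  (Finset.card_filter_le _ _).trans (Finset.card_image_le.trans (by simp))

lemma normalize_normalize (v : Fin n → F) : normalize (normalize v) = normalize v := by
  obtain ⟨c, hc, hv⟩ := exists_eq_smul_normalize v
  conv_rhs => rw [hv, normalize_smul hc]

lemma map_normalize {q : (Fin n → F) →ₗ[F] (Fin n → F)} (hqq : ∀ a, q (q a) = q a)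
    (b : Fin n → F) : q (normalize (q b)) = normalize (q b) := by
  obtain ⟨c, hc, hv⟩ := exists_eq_smul_normalize (q b)
  have h2 : normalize (q b) = c⁻¹ • q b := by rw [eq_inv_smul_iff₀ hc, ← hv]
  rw [h2, map_smul, hqq]

lemma normalize_mem_iff {V : Submodule F (Fin n → F)} {v : Fin n → F} :
    normalize v ∈ V ↔ v ∈ V := by
  obtain ⟨c, hc, hv⟩ := exists_eq_smul_normalize v
  conv_rhs => rw [hv, V.smul_mem_iff hc]

lemma exists_functional_of_linearIndependent {V : Finset (Fin n → F)}
    (hV : LinearIndependent F (fun v : V => (v : Fin n → F))) (g : (Fin n → F) → F) :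
    ∃ l : (Fin n → F) →ₗ[F] F, ∀ v ∈ V, l v = g v := by
  obtain ⟨l, hl⟩ := LinearMap.exists_extend
    ((Module.Basis.span hV).constr F fun v => g (v : Fin n → F))
  refine ⟨l, fun v hv => ?_⟩
  have h1 := congrArg (fun f => f (Module.Basis.span hV ⟨v, hv⟩)) hl
  simp only [Module.Basis.constr_basis, LinearMap.comp_apply, Submodule.subtype_apply] at h1
  rw [← h1, Module.Basis.span_apply]

/-- The relation between the terms restricts to the forms lying in a subspace containing `K`. -/
lemma sum_innerPart_eq_zero (W : Submodule F (Fin n → F)) {d : ℕ}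
    {ι : Type*} [Fintype ι] {a : ι → Fin d → Fin n → F} {r : Fin d → Fin n → F}
    (h : ∀ i j, a i j - r j ∈ W) {β : ι → F}
    (hβ : ∑ i, β i • ∏ j, linForm (a i j) = 0) : ∑ i, β i • innerPart W r (a i) = 0 := by
  refine innerPart_relation_mono (K' := ⊤) le_top h ?_
  simpa [innerPart] using hβ

/-- If a relation between aligned terms is minimal on the parts inside `K`, then the classes
modulo `K` that vary between the terms form a Sylvester-Gallai closed configuration. -/
lemma sgClosed_varyingClasses {K : Submodule F (Fin n → F)}
    {q : (Fin n → F) →ₗ[F] (Fin n → F)} (hq : ∀ a, q a = 0 ↔ a ∈ K)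
    (hqq : ∀ a, q (q a) = q a) {d m : ℕ} {ι : Type*} [Fintype ι] (hι : Fintype.card ι = m + 1)
    (hm : 1 ≤ m) {a : ι → Fin d → Fin n → F} (ha : ∀ i j, a i j ≠ 0) {r : Fin d → Fin n → F}
    (h : ∀ i j, a i j - r j ∈ K) {β : ι → F} (hβ : ∑ i, β i • ∏ j, linForm (a i j) = 0)
    (hmin : ∀ A : Finset ι, A.Nonempty → A ≠ Finset.univ →
      ∑ i ∈ A, β i • innerPart K r (a i) ≠ 0) :
    SGClosed m (varyingClasses q r a) := by
  classical
  have hS : ∀ x ∈ varyingClasses q r a, x ≠ 0 ∧ (∃ j, normalize (q (r j)) = x) ∧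
      ∃ i i', node q r (a i) x ≠ node q r (a i') x := fun x hx => by
    obtain ⟨h1, h2, h3⟩ := mem_varyingClasses.1 hx
    exact ⟨h2, h1, h3⟩
  refine ⟨fun v hv => (hS v hv).1, fun u hu v hv huv c huc => ?_, fun V hVS hVc hV => ?_⟩
  · obtain ⟨hu0, ⟨j, rfl⟩, -⟩ := hS u hu
    obtain ⟨hv0, ⟨j', rfl⟩, -⟩ := hS v hv
    have hc : c ≠ 0 := fun hc => hu0 (by rw [huc, hc, zero_smul])
    apply huv
    rw [← normalize_normalize, huc, normalize_smul hc, normalize_normalize]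
  by_contra hlt
  push Not at hlt
  have hVsub : (V : Set (Fin n → F)) ⊆
      {v | v ∈ varyingClasses q r a ∧ v ∈ Submodule.span F (V : Set (Fin n → F))} :=
    fun v hv => ⟨hVS hv, Submodule.subset_span hv⟩
  have hfin : {v | v ∈ varyingClasses q r a ∧
      v ∈ Submodule.span F (V : Set (Fin n → F))}.Finite :=
    (varyingClasses q r a).finite_toSet.subset fun v hv => hv.1
  have hVeq := Set.eq_of_subset_of_ncard_le hVsub (by
    rw [Set.ncard_coe_finset]; omega) hfin
  have hqV : ∀ v ∈ V, q v = v := fun v hv => by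
    obtain ⟨-, ⟨j, rfl⟩, -⟩ := hS v (hVS hv)
    exact map_normalize hqq _
  set W := K ⊔ Submodule.span F (V : Set (Fin n → F)) with hW
  have hrW : ∀ b, b ∈ W ↔ q b ∈ Submodule.span F (V : Set (Fin n → F)) := by
    intro b
    constructor
    · intro hb
      obtain ⟨y, hy, z, hz, rfl⟩ := Submodule.mem_sup.1 hb
      have hqz : q z = z := by
        have := LinearMap.eqOn_span (f := q) (g := LinearMap.id) (fun v hv => hqV v hv) hz
        simpa using this
      rwa [map_add, (hq y).2 hy, zero_add, hqz]
    · intro hb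
      rw [← sub_add_cancel b (q b)]
      exact Submodule.add_mem_sup (by rw [← hq, map_sub, hqq, sub_self]) hb
  set Z := (Finset.univ.image fun j => normalize (q (r j))).filter fun x =>
    x ∈ Submodule.span F (V : Set (Fin n → F)) ∧ x ∉ insert 0 V with hZ
  -- No varying class outside `V` lies in its span, so the remaining nodes inside `W` are common to
  -- all terms and cancel.
  have hZconst : ∀ x ∈ Z, ∀ i i', node q r (a i) x = node q r (a i') x := by
    intro x hx i i'
    obtain ⟨h1, h2, h3⟩ := Finset.mem_filter.1 hx
    rw [Finset.mem_insert, not_or] at h3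
    by_contra hne
    have hxS : x ∈ varyingClasses q r a := mem_varyingClasses.2
      ⟨by simpa using h1, h3.1, i, i', hne⟩
    have : x ∈ (V : Set (Fin n → F)) := hVeq ▸ ⟨hxS, h2⟩
    exact h3.2 this
  have h0V : (0 : Fin n → F) ∉ V := fun h0 => (hS 0 (hVS h0)).1 rfl
  have hdisj : Disjoint (insert 0 V) Z :=
    Finset.disjoint_right.2 fun x hx => (Finset.mem_filter.1 hx).2.2
  have hinner : ∀ i, innerPart W r (a i) =
      innerPart K r (a i) * (∏ v ∈ V, node q r (a i) v) * ∏ x ∈ Z, node q r (a i) x := by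
    intro i
    rw [innerPart_eq_node hq, ← Finset.prod_insert h0V, ← Finset.prod_union hdisj, prod_node,
      innerPart]
    congr 1
    refine Finset.filter_congr fun j _ => ?_
    rw [hrW, ← normalize_mem_iff]
    constructor
    · intro hj
      by_cases hj' : normalize (q (r j)) ∈ insert 0 V
      · exact Finset.mem_union_left _ hj'
      · exact Finset.mem_union_right _ (Finset.mem_filter.2
          ⟨Finset.mem_image_of_mem _ (Finset.mem_univ j), hj, hj'⟩)
    · intro hj
      rcases Finset.mem_union.1 hj with hj | hj
      · rcases Finset.mem_insert.1 hj with hj | hj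
        · rw [hj]; exact zero_mem _
        · exact Submodule.subset_span hj
      · exact (Finset.mem_filter.1 hj).2.1
  obtain ⟨i₀⟩ : Nonempty ι := Fintype.card_pos_iff.1 (by omega)
  have hrel : ∑ i, (β i • innerPart K r (a i)) * ∏ v ∈ V, node q r (a i) v = 0 := by
    have h1 := sum_innerPart_eq_zero W (fun i j => (le_sup_left : K ≤ W) (h i j)) hβ
    have h2 : ∀ i, β i • innerPart W r (a i) =
        ((β i • innerPart K r (a i)) * ∏ v ∈ V, node q r (a i) v) *
          ∏ x ∈ Z, node q r (a i₀) x := fun i => by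
      rw [hinner, smul_mul_assoc, smul_mul_assoc]
      congr 2
      exact Finset.prod_congr rfl fun x hx => hZconst x hx i i₀
    simp only [h2] at h1
    rw [← Finset.sum_mul] at h1
    exact (mul_eq_zero.1 h1).resolve_right
      (Finset.prod_ne_zero_iff.2 fun x _ => node_ne_zero q r (ha i₀) x)
  -- Translate along a functional that is `0` on `K` and `B` and `1` on `V \ B`. In the top
  -- coefficient the nodes of `V \ B` become one nonzero scalar common to all terms.
  have hrelB : ∀ B ⊆ V, ∑ i, (β i • innerPart K r (a i)) * ∏ v ∈ B, node q r (a i) v = 0 := by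
    intro B hB
    obtain ⟨l₀, hl₀⟩ := exists_functional_of_linearIndependent hV
      (fun v => if v ∈ B then 0 else 1)
    set l := l₀ ∘ₗ q with hl
    have hlK : ∀ b ∈ K, l b = 0 := fun b hb => by simp [hl, (hq b).2 hb]
    have hla : ∀ i j, l (a i j) = l (r j) := fun i j => by
      rw [← sub_eq_zero, ← map_sub]; exact hlK _ (h i j)
    have hl1 : ∀ j, normalize (q (r j)) ∈ V \ B → l (r j) ≠ 0 := by
      intro j hj
      obtain ⟨e, he, hve⟩ := exists_eq_smul_normalize (q (r j))
      rw [Finset.mem_sdiff] at hj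
      rw [hl, LinearMap.comp_apply, hve, map_smul, hl₀ _ hj.1, if_neg hj.2]
      simpa using he
    have hl2 : ∀ j, normalize (q (r j)) ∈ insert 0 B → l (r j) = 0 := by
      intro j hj
      obtain ⟨e, he, hve⟩ := exists_eq_smul_normalize (q (r j))
      rw [hl, LinearMap.comp_apply, hve, map_smul]
      rcases Finset.mem_insert.1 hj with hj | hj
      · rw [hj]; simp
      · rw [hl₀ _ (hB hj), if_pos hj, smul_zero]
    have h0B : (0 : Fin n → F) ∉ B := fun h0 => h0V (hB h0)
    set N := Finset.univ.filter fun j => normalize (q (r j)) ∈ V \ B with hN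
    have h2 : ∀ i, (translate l ((β i • innerPart K r (a i)) *
        ∏ v ∈ V, node q r (a i) v)).coeff N.card =
        ((β i • innerPart K r (a i)) * ∏ v ∈ B, node q r (a i) v) * C (∏ j ∈ N, l (r j)) := by
      intro i
      have h3 : (β i • innerPart K r (a i)) * ∏ v ∈ V, node q r (a i) v =
          β i • ((∏ v ∈ insert 0 B, node q r (a i) v) * ∏ v ∈ V \ B, node q r (a i) v) := by
        rw [Finset.prod_insert h0B, ← innerPart_eq_node hq, ← Finset.prod_sdiff hB,
          smul_mul_assoc]
        congr 1
        ring
      rw [h3, map_smul, Polynomial.coeff_smul, map_mul, prod_node, prod_node,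
        translate_prod_eq (fun j hj => by rw [hla]; exact hl2 j (Finset.mem_filter.1 hj).2),
        Polynomial.coeff_C_mul, coeff_card_translate_prod, ← prod_node, Finset.prod_insert h0B,
        ← innerPart_eq_node hq, smul_mul_assoc, smul_mul_assoc]
      simp only [hla, hN]
    have h1 := congrArg (fun p => (translate l p).coeff N.card) hrel
    simp only [map_sum, Polynomial.finsetSum_coeff, h2, map_zero, Polynomial.coeff_zero] at h1
    rw [← Finset.sum_mul] at h1
    refine (mul_eq_zero.1 h1).resolve_right ?_
    rw [MvPolynomial.C_eq_zero]
    exact Finset.prod_ne_zero_iff.2 fun j hj => hl1 j (Finset.mem_filter.1 hj).2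
  let ψ := algebraMap (MvPolynomial (Fin n) F) (FractionRing (MvPolynomial (Fin n) F))
  have hψ : Function.Injective ψ := IsFractionRing.injective _ _
  obtain ⟨A, hA, hAu, hA0⟩ := exists_subset_sum_eq_zero_of_orthogonal V
    (fun i => ψ (β i • innerPart K r (a i))) (fun v i => ψ (node q r (a i) v))
    (fun v hv => by
      obtain ⟨-, -, i, i', hii'⟩ := hS v (hVS hv)
      exact ⟨i, i', hψ.ne hii'⟩) (by omega) (by omega) (fun B hB => by
      simp only [← map_prod, ← map_mul, ← map_sum]
      rw [hrelB B hB, map_zero])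
  refine hmin A hA hAu (hψ ?_)
  rw [map_sum, map_zero]
  exact hA0

/-- Discard `v` from `V`: the span of the rest already holds `m + 1` vectors of `S`, and `v` is one
more. This absorbs relations shorter than the maximum. -/
lemma SGClosed.succ {m : ℕ} {S : Finset (Fin n → F)} (h : SGClosed m S) : SGClosed (m + 1) S := by
  classical
  refine ⟨h.1, h.2.1, fun V hVS hVc hV => ?_⟩
  obtain ⟨v, hv⟩ : V.Nonempty := Finset.card_pos.1 (by omega)
  have hsub : V.erase v ⊆ V := Finset.erase_subset v V
  have h1 := h.2.2 (V.erase v) (hsub.trans hVS) (by rw [Finset.card_erase_of_mem hv]; omega)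
    (hV.comp (fun u : V.erase v => (⟨u, hsub u.2⟩ : V)) fun u w huw =>
      Subtype.ext (congrArg (fun z : V => (z : Fin n → F)) huw))
  have hnot : v ∉ Submodule.span F ((V.erase v : Finset _) : Set (Fin n → F)) := by
    have h2 := linearIndependent_iff_notMem_span.1 hV ⟨v, hv⟩
    have h3 : (fun u : V => (u : Fin n → F)) '' (Set.univ \ {⟨v, hv⟩}) =
        ((V.erase v : Finset _) : Set (Fin n → F)) := by
      refine Set.ext fun u => ⟨?_, fun hu => ?_⟩
      · rintro ⟨w, ⟨-, hw⟩, rfl⟩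
        exact Finset.mem_erase.2 ⟨fun h => hw (Subtype.ext h), w.2⟩
      · obtain ⟨hu1, hu2⟩ := Finset.mem_erase.1 hu
        exact ⟨⟨u, hu2⟩, ⟨trivial, fun h => hu1 (congrArg Subtype.val h)⟩, rfl⟩
    rwa [h3] at h2
  set P := {u : Fin n → F | u ∈ S ∧ u ∈ Submodule.span F ((V.erase v : Finset _) : Set _)}
  have hP : P.Finite := S.finite_toSet.subset fun u hu => hu.1
  have h3 : (insert v P).ncard = P.ncard + 1 := Set.ncard_insert_of_notMem (fun hvP => hnot hvP.2) hP
  have h4 : (insert v P).ncard ≤ _ := Set.ncard_le_ncard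
    (t := {u : Fin n → F | u ∈ S ∧ u ∈ Submodule.span F (V : Set (Fin n → F))}) (by
      rintro u (rfl | hu)
      · exact ⟨hVS hv, Submodule.subset_span hv⟩
      · exact ⟨hu.1, Submodule.span_mono (by exact_mod_cast hsub) hu.2⟩)
    (S.finite_toSet.subset fun u hu => hu.1)
  omega

lemma SGClosed.mono {m m' : ℕ} (hm : m ≤ m') {S : Finset (Fin n → F)} (h : SGClosed m S) :
    SGClosed m' S := by
  induction m', hm using Nat.le_induction with
  | base => exact h
  | succ m' _ ih => exact ih.succ

lemma SGClosed.finrank_le_SG {m d : ℕ} {S : Finset (Fin n → F)} (h : SGClosed m S)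
    (hd : S.card ≤ d) :
    Module.finrank F (Submodule.span F (S : Set (Fin n → F))) ≤ SG F m d := by
  -- `sSup` of an unbounded set of naturals is `0`, hence the need for the bound `d`.
  refine le_csSup ⟨d, ?_⟩ ⟨n, S, hd, h, rfl⟩
  rintro _ ⟨N, S', hS', -, rfl⟩
  exact (finrank_span_finset_le_card S').trans hS'

end Closure

/-! ### Fundamental relations and the rank bound -/

section Rank

variable {F : Type*} [Field F] {n : ℕ}

/-- A maximal independent set of terms. -/
lemma Circuit.exists_basis {k d : ℕ} (T : Circuit F n k d) :
    ∃ I : Finset (Fin k), I.card = T.indFanin ∧ LinearIndepOn F T.term (I : Set (Fin k)) ∧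
      ∀ j ∉ I, T.term j ∈ Submodule.span F (T.term '' (I : Set (Fin k))) := by
  classical
  have hmem : ∀ I : Finset (Fin k), I ∈ (Finset.univ.filter fun I : Finset (Fin k) =>
      LinearIndependent F (fun i : I => T.term i)) ↔ LinearIndepOn F T.term (I : Set (Fin k)) :=
    fun I => by rw [Finset.mem_filter]; exact ⟨fun h => h.2, fun h => ⟨Finset.mem_univ _, h⟩⟩
  obtain ⟨I, hI, hcard⟩ := Finset.exists_mem_eq_sup _
    ⟨∅, (hmem ∅).2 (by simp)⟩ Finset.card
  refine ⟨I, by rw [Circuit.indFanin]; exact hcard.symm, (hmem I).1 hI, fun j hj => ?_⟩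
  by_contra hnot
  have h1 : insert j I ∈ (Finset.univ.filter fun I : Finset (Fin k) =>
      LinearIndependent F (fun i : I => T.term i)) := by
    rw [hmem, Finset.coe_insert, linearIndepOn_insert (by simpa using hj)]
    exact ⟨(hmem I).1 hI, hnot⟩
  have h2 := Finset.le_sup (f := Finset.card) h1
  rw [hcard, Finset.card_insert_of_notMem hj] at h2
  omega

/-- The fundamental relation expressing a term through a basis. -/
lemma exists_fundamental_relation {k : ℕ} {M : Type*} [AddCommGroup M] [Module F M] {t : Fin k → M}
    {I : Finset (Fin k)} {j : Fin k} (hj : j ∉ I)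
    (h : t j ∈ Submodule.span F (t '' (I : Set (Fin k)))) :
    ∃ γ : Fin k → F, ∑ i, γ i • t i = 0 ∧ (∀ i ∉ I, i ≠ j → γ i = 0) ∧ γ j = -1 := by
  classical
  obtain ⟨c, hc⟩ := (Submodule.mem_span_image_finset_iff_exists_fun F).1 h
  set c' : Fin k → F := fun i => if hi : i ∈ I then c ⟨i, hi⟩ else 0
  have hc' : ∑ i ∈ I, c' i • t i = t j := by
    rw [← hc, ← Finset.sum_coe_sort I]
    exact Finset.sum_congr rfl fun i _ => by simp [c']
  refine ⟨fun i => (if i ∈ I then c' i else 0) - if i = j then 1 else 0, ?_, fun i hi hij => ?_, ?_⟩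
  · simp [sub_smul, Finset.sum_sub_distrib, ite_smul, Finset.sum_ite_mem, hc']
  · simp [hi, hij]
  · simp [hj]

/-- A function that is constant along the support of every fundamental relation is constant, if
no proper nonempty subset of the vectors sums to zero. -/
lemma eq_of_constant_on_relations {k : ℕ} {M X : Type*} [AddCommGroup M] [Module F M]
    {t : Fin k → M} {I : Finset (Fin k)} (hI : LinearIndepOn F t (I : Set (Fin k)))
    {γ : Fin k → Fin k → F} (hγ : ∀ j ∉ I, ∑ i, γ j i • t i = 0)
    (hγ₀ : ∀ j ∉ I, ∀ i ∉ I, i ≠ j → γ j i = 0) (hγ₁ : ∀ j ∉ I, γ j j = -1)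
    (hsum : ∑ i, t i = 0)
    (hmin : ∀ S : Finset (Fin k), S.Nonempty → S ≠ Finset.univ → ∑ i ∈ S, t i ≠ 0)
    (g : Fin k → X) (hg : ∀ j ∉ I, ∀ i, γ j i ≠ 0 → g i = g j) (i i' : Fin k) : g i = g i' := by
  classical
  have hout : ∀ e ∉ I, 1 + ∑ j ∈ Iᶜ, γ j e = 0 := by
    intro e he
    rw [Finset.sum_eq_single_of_mem e (Finset.mem_compl.2 he) fun j hj hje =>
      hγ₀ j (Finset.mem_compl.1 hj) e he hje.symm, hγ₁ e he, add_neg_cancel]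
  have htotal : ∑ e, (1 + ∑ j ∈ Iᶜ, γ j e) • t e = 0 := by
    simp only [add_smul, one_smul, Finset.sum_add_distrib, hsum, zero_add, Finset.sum_smul]
    rw [Finset.sum_comm]
    exact Finset.sum_eq_zero fun j hj => hγ j (Finset.mem_compl.1 hj)
  -- The identity plus all fundamental relations is a relation supported on the independent set `I`,
  -- so it is trivial.
  have hzero : ∀ e, 1 + ∑ j ∈ Iᶜ, γ j e = 0 := by
    intro e
    by_cases he : e ∈ I
    · refine linearIndepOn_finset_iff.1 hI (fun e => 1 + ∑ j ∈ Iᶜ, γ j e) ?_ e he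
      rw [← Finset.sum_add_sum_compl I] at htotal
      rwa [Finset.sum_eq_zero (s := Iᶜ) fun e he => by
        rw [hout e (Finset.mem_compl.1 he), zero_smul], add_zero] at htotal
    · exact hout e he
  by_contra hne
  set A := Finset.univ.filter fun e => g e = g i with hA
  refine hmin A ⟨i, by simp [hA]⟩ (fun hAu => ?_) ?_
  · have : i' ∈ A := hAu ▸ Finset.mem_univ i'
    exact hne (Finset.mem_filter.1 this).2.symm
  -- So the identity is minus the sum of the fundamental relations, each of which lies entirely
  -- inside the level set `A` or misses it.
  · have h1 : ∑ e ∈ A, t e = -∑ j ∈ Iᶜ, ∑ e ∈ A, γ j e • t e := by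
      rw [Finset.sum_comm, ← Finset.sum_neg_distrib]
      refine Finset.sum_congr rfl fun e _ => ?_
      rw [← Finset.sum_smul, ← neg_smul, ← eq_neg_of_add_eq_zero_left (hzero e), one_smul]
    rw [h1, neg_eq_zero]
    refine Finset.sum_eq_zero fun j hj => ?_
    have hj' := Finset.mem_compl.1 hj
    by_cases hjA : g j = g i
    · rw [← hγ j hj']
      refine Finset.sum_subset (Finset.subset_univ _) fun e _ he => ?_
      by_cases h0 : γ j e = 0
      · rw [h0, zero_smul]
      · exact absurd (by simp [hA, hg j hj' e h0, hjA]) he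
    · refine Finset.sum_eq_zero fun e he => ?_
      by_cases h0 : γ j e = 0
      · rw [h0, zero_smul]
      · exact absurd ((hg j hj' e h0).symm.trans (Finset.mem_filter.1 he).2) hjA

/-- The classes varying along a fundamental relation form a Sylvester-Gallai closed set. -/
lemma sgClosed_of_fundamental_relation {K : Submodule F (Fin n → F)}
    {q : (Fin n → F) →ₗ[F] (Fin n → F)} (hq : ∀ a, q a = 0 ↔ a ∈ K)
    (hqq : ∀ a, q (q a) = q a) {k d : ℕ} {a : Fin k → Fin d → Fin n → F}
    (ha : ∀ i j, a i j ≠ 0) {r : Fin d → Fin n → F} (h : ∀ i j, a i j - r j ∈ K)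
    {I : Finset (Fin k)}
    (hI : LinearIndepOn F (fun i => innerPart K r (a i)) (I : Set (Fin k))) {β : Fin k → F}
    (hβ : ∑ i, β i • ∏ j, linForm (a i j) = 0) {e : Fin k} (hβI : ∀ i ∉ I, i ≠ e → β i = 0)
    (hβe : β e ≠ 0) {m : ℕ} (hm : I.card ≤ m) :
    SGClosed m (varyingClasses q r fun i : {i // β i ≠ 0} => a i) := by
  classical
  have hβ' : ∑ i : {i // β i ≠ 0}, β i • ∏ j, linForm (a i j) = 0 := by
    rw [← hβ, ← Finset.sum_subtype (Finset.univ.filter fun i => β i ≠ 0) (by simp)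
      fun i => β i • ∏ j, linForm (a i j)]
    exact Finset.sum_filter_of_ne fun i _ hne h0 => hne (by rw [h0, zero_smul])
  have hcard : Fintype.card {i // β i ≠ 0} ≤ I.card + 1 := by
    rw [Fintype.card_subtype]
    refine (Finset.card_le_card (t := insert e I) fun i hi => ?_).trans (Finset.card_insert_le _ _)
    by_contra hi'
    rw [Finset.mem_insert, not_or] at hi'
    exact (Finset.mem_filter.1 hi).2 (hβI i hi'.2 hi'.1)
  have hcard2 : 2 ≤ Fintype.card {i // β i ≠ 0} := by
    by_contra hlt
    have h1 : Fintype.card {i // β i ≠ 0} = 1 :=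
      le_antisymm (by omega) (Fintype.card_pos_iff.2 ⟨⟨e, hβe⟩⟩)
    have := Fintype.card_le_one_iff_subsingleton.1 h1.le
    rw [Fintype.sum_subsingleton _ (⟨e, hβe⟩ : {i // β i ≠ 0})] at hβ'
    exact (smul_ne_zero hβe (prod_linForm_ne_zero fun j _ => ha e j)) hβ'
  obtain ⟨m', hm'⟩ : ∃ m', Fintype.card {i // β i ≠ 0} = m' + 1 :=
    ⟨_, (Nat.sub_add_cancel (by omega : 1 ≤ Fintype.card {i // β i ≠ 0})).symm⟩
  refine SGClosed.mono (by omega : m' ≤ m) (sgClosed_varyingClasses hq hqq hm' (by omega)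
    (fun i j => ha i j) (fun i j => h i j) (β := fun i => β i) hβ' ?_)
  -- A subsum avoiding `e` involves only independent inner parts. One containing `e` is minus its
  -- complement, because the inner parts satisfy the full relation.
  have hnot : ∀ A : Finset {i // β i ≠ 0}, A.Nonempty → ⟨e, hβe⟩ ∉ A →
      ∑ i ∈ A, β i • innerPart K r (a i) ≠ 0 := by
    rintro A ⟨i, hi⟩ he h0
    set A' := A.map (Function.Embedding.subtype _) with hA'
    have hAI : (A' : Set (Fin k)) ⊆ I := by
      intro x hx
      obtain ⟨y, hy, rfl⟩ := Finset.mem_map.1 (Finset.mem_coe.1 hx)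
      by_contra hyI
      refine y.2 (hβI _ hyI fun hye => he ?_)
      rwa [show y = ⟨e, hβe⟩ from Subtype.ext hye] at hy
    refine i.2 (linearIndepOn_finset_iff.1 (hI.mono hAI) β ?_ i
      (Finset.mem_map_of_mem _ hi))
    rw [hA', Finset.sum_map]
    exact h0
  intro A hA hAu
  by_cases he : ⟨e, hβe⟩ ∈ A
  · intro h0
    have h1 := sum_innerPart_eq_zero K (fun (i : {i // β i ≠ 0}) j => h i j) (β := fun i => β i) hβ'
    rw [← Finset.sum_add_sum_compl A, h0, zero_add] at h1
    refine hnot Aᶜ ?_ (by simpa using he) h1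
    rwa [Finset.nonempty_iff_ne_empty, Ne, Finset.compl_eq_empty_iff]
  · exact hnot A hA he

lemma finrank_finset_sup_le {ι : Type*} (s : Finset ι) (f : ι → Submodule F (Fin n → F)) :
    Module.finrank F (s.sup f : Submodule F (Fin n → F)) ≤ ∑ i ∈ s, Module.finrank F (f i) := by
  classical
  induction s using Finset.induction_on with
  | empty => simp
  | insert i s hi ih =>
    rw [Finset.sup_insert, Finset.sum_insert hi]
    exact (Submodule.finrank_add_le_finrank_add_finrank _ _).trans (Nat.add_le_add_left ih _)

/-- The parameter `m` is left free so that both `k'` and `k` can be used. -/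
lemma Circuit.rank_le {k d : ℕ} (T : Circuit F n k d) (hid : T.IsIdentity) (hsimple : T.IsSimple)
    (hmin : T.IsMinimal) {m : ℕ} (hm : T.indFanin ≤ m) :
    T.rank ≤ 2 * k ^ 2 + (k - T.indFanin) * SG F m d := by
  classical
  rcases Nat.eq_zero_or_pos k with rfl | hk
  · simp [Circuit.rank]
  obtain ⟨K₀, hK₀, hmatch⟩ := T.exists_matched hid hmin ⟨0, hk⟩
  obtain ⟨a, b, r, hterm, hb, ha, hr, hform⟩ := T.exists_aligned hmatch
  obtain ⟨I, hIcard, hI, hspan⟩ := T.exists_basis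
  have hterm' : ∀ i, T.term i = b i • ∏ j, linForm (a i j) := fun i => by
    rw [hterm, smul_eq_C_mul]
  have hprod : LinearIndependent F fun i : I => ∏ j, linForm (a i j) := by
    rw [Fintype.linearIndependent_iff]
    intro c hc i
    have h1 := Fintype.linearIndependent_iff.1 hI (fun i : I => c i * (b i)⁻¹) (by
      rw [← hc]
      refine Finset.sum_congr rfl fun i _ => ?_
      rw [hterm', smul_smul, inv_mul_cancel_right₀ (hb _)]) i
    exact (mul_eq_zero.1 h1).resolve_right (inv_ne_zero (hb _))
  obtain ⟨K, hK, hKr, hKI⟩ := exists_linearIndependent_innerPart K₀ (fun (i : I) j => hr i j) hprod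
  have hr' : ∀ i j, a i j - r j ∈ K := fun i j => hK (hr i j)
  obtain ⟨q, hq, hqq⟩ := exists_projection K
  have hγ : ∀ j, ∃ γ : Fin k → F, j ∉ I → ∑ i, γ i • T.term i = 0 ∧
      (∀ i ∉ I, i ≠ j → γ i = 0) ∧ γ j = -1 := fun j => by
    by_cases hj : j ∈ I
    · exact ⟨0, fun h => absurd hj h⟩
    · obtain ⟨γ, hγ⟩ := exists_fundamental_relation hj (hspan j hj)
      exact ⟨γ, fun _ => hγ⟩
  choose γ hγ using hγ
  let S : Fin k → Finset (Fin n → F) := fun j =>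
    varyingClasses q r fun i : {i // γ j i * b i ≠ 0} => a i
  have hS : ∀ j ∉ I, SGClosed m (S j) := fun j hj => by
    refine sgClosed_of_fundamental_relation hq hqq ha hr' hKI (β := fun i => γ j i * b i) (e := j)
      ?_ (fun i hi hij => by rw [(hγ j hj).2.1 i hi hij, zero_mul])
      (by rw [(hγ j hj).2.2]; simpa using hb j) (hIcard.trans_le hm)
    rw [← (hγ j hj).1]
    exact Finset.sum_congr rfl fun i _ => by rw [hterm', smul_smul]
  have hSd : ∀ j, (S j).card ≤ d := fun j => card_varyingClasses_le q r _
  -- A class varying along no fundamental relation has a node common to all terms, which simplicity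
  -- forbids.
  have hcover : ∀ e, r e ∉ K → ∃ j ∉ I, normalize (q (r e)) ∈ S j := by
    intro e he
    by_contra! hno
    refine hsimple ⟨a ⟨0, hk⟩ e, ha _ _, fun i => ?_⟩
    have hconst := eq_of_constant_on_relations hI (fun j hj => (hγ j hj).1)
      (fun j hj => (hγ j hj).2.1) (fun j hj => (hγ j hj).2.2) hid hmin
      (fun i => node q r (a i) (normalize (q (r e)))) (fun j hj i hi => by
        by_contra hne
        refine hno j hj (mem_varyingClasses.2 ⟨⟨e, rfl⟩, ?_, ⟨i, mul_ne_zero hi (hb i)⟩,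
          ⟨j, mul_ne_zero (by rw [(hγ j hj).2.2]; simp) (hb j)⟩, hne⟩)
        rw [Ne, normalize_eq_zero, hq]
        exact he) ⟨0, hk⟩ i
    have h1 : linForm (a ⟨0, hk⟩ e) ∣ node q r (a ⟨0, hk⟩) (normalize (q (r e))) :=
      Finset.dvd_prod_of_mem _ (by simp)
    rw [hterm]
    refine (h1.trans ?_).mul_left _
    rw [hconst]
    exact Finset.prod_dvd_prod_of_subset _ _ _ (Finset.subset_univ _)
  have hle : Submodule.span F {x : Fin n → F | ∃ i j, T.form i j = x} ≤
      K ⊔ Iᶜ.sup fun j => Submodule.span F (S j : Set (Fin n → F)) := by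
    rw [Submodule.span_le]
    rintro _ ⟨i, j, rfl⟩
    obtain ⟨e, c, hc⟩ := hform i j
    rw [hc, SetLike.mem_coe]
    refine Submodule.smul_mem _ _ ?_
    by_cases he : r e ∈ K
    · refine Submodule.mem_sup_left ?_
      rw [← sub_add_cancel (a i e) (r e)]
      exact K.add_mem (hr' i e) he
    · obtain ⟨j₁, hj₁, hmem⟩ := hcover e he
      rw [← sub_add_cancel (a i e) (q (r e))]
      refine Submodule.add_mem_sup ?_ ?_
      · rw [← hq, map_sub, hqq, ← map_sub, hq]; exact hr' i e
      · refine Finset.le_sup (f := fun j => Submodule.span F (S j : Set (Fin n → F)))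
          (Finset.mem_compl.2 hj₁) ?_
        exact normalize_mem_iff.1 (Submodule.subset_span hmem)
  have h1 := (Submodule.finrank_mono hle).trans (Submodule.finrank_add_le_finrank_add_finrank _ _)
  have h2 : ∑ j ∈ Iᶜ, Module.finrank F (Submodule.span F (S j : Set (Fin n → F))) ≤
      (k - T.indFanin) * SG F m d := by
    refine (Finset.sum_le_card_nsmul _ _ (SG F m d) fun j hj =>
      (hS j (Finset.mem_compl.1 hj)).finrank_le_SG (hSd j)).trans ?_
    rw [Finset.card_compl, Fintype.card_fin, hIcard, smul_eq_mul]
  have h3 := finrank_finset_sup_le Iᶜ fun j => Submodule.span F (S j : Set (Fin n → F))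
  -- One `k ^ 2` pays for the matching, the other for the independence of the inner parts.
  have h4 : Fintype.card I ^ 2 ≤ k ^ 2 := by
    refine Nat.pow_le_pow_left ?_ 2
    simpa using Finset.card_le_univ I
  rw [Circuit.rank]
  omega

end Rank

end

end DepthThree

theorem mainTheorem2 {F : Type*} [Field F] {n k d k' : ℕ} (hF : (d : ℕ∞) < ENat.card F)
    (C : DepthThree.Circuit F n k d) (hid : C.IsIdentity) (hsimple : C.IsSimple)
    (hmin : C.IsMinimal) (hk' : C.indFanin = k') :
    C.rank ≤ 2 * k ^ 2 + (k - k') * DepthThree.SG F k' d ∧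
      C.rank ≤ 2 * k ^ 2 + k * DepthThree.SG F k d := by
  subst hk'
  refine ⟨C.rank_le hid hsimple hmin le_rfl, ?_⟩
  obtain ⟨I, hI, -⟩ := C.exists_basis
  have hle : C.indFanin ≤ k := by
    rw [← hI]
    simpa using Finset.card_le_univ I
  exact (C.rank_le hid hsimple hmin hle).trans
    (Nat.add_le_add_left (Nat.mul_le_mul_right _ (Nat.sub_le _ _)) _)
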